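/- Let $M$ be a smooth manifold of dimension $n\ge 3$ with a conformal structure of positive definite signature. In a scale (a metric $g$ of the conformal class, with Levi-Civita connection $\nabla$ and Schouten tensor $\mathsf P_{ab}=\frac1{n-2}\big(\mathrm{Ric}_{ab}-\frac{\mathrm{Scal}}{2(n-1)}g_{ab}\big)$) standard tractors are triples $(\sigma,\mu^a,\rho)$, with the tractor metric $\langle(\sigma,\mu,\rho),(\tau,\nu,\pi)\rangle=g(\mu,\nu)+\sigma\pi+\rho\tau$ and the tractor connection $\nabla_a(\sigma,\mu^b,\rho)=(\nabla_a\sigma-\mu_a,\ \nabla_a\mu^b+\delta_a{}^b\rho+\mathsf P_a{}^b\sigma,\ \nabla_a\rho-\mathsf P_{ac}\mu^c)$. For a smooth regular curve with parameter $t$ and velocity $U^a$ put $u=\sqrt{U_cU^c}$, $\mathbf T=(0,0,u^{-1})$, $\mathbf U=\frac{d}{dt}\mathbf T$, $\mathbf U^{(i)}=\frac{d^{i+1}}{dt^{i+1}}\mathbf T$, where $\frac{d}{dt}=U^c\nabla_c$ is the tractor derivative along the curve, and let $\Delta_j$ be the determinant of the Gram matrix of the first $j$ of the tractors $\mathbf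 T,\mathbf U,\mathbf U',\mathbf U'',\dots$. Assume that the curve is generic: $\mathbf T,\mathbf U,\mathbf U',\dots,\mathbf U^{(n)}$ are linearly independent at each point. Put $\Phi=\langle\mathbf U'',\mathbf U''\rangle-\langle\mathbf U',\mathbf U'\rangle^2=-\Delta_4$; a conformal arc-length is a parameter $s$ with $ds=\Phi^{1/4}\,dt$. For the parametrization of the curve by the conformal arc-length $s$, the tractor Frenet frame $\mathbf U_0,\dots,\mathbf U_{n+1}$ is given by $\mathbf U_0=\mathbf T$, $\mathbf U_1=\mathbf U$, $\mathbf U_2=-\mathbf U'-\frac12\langle\mathbf U',\mathbf U'\rangle\mathbf T$, and, for $3\le i\le n+1$, by $\mathbf U_i=\mathbf V_i/\sqrt{\langle\mathbf V_i,\mathbf V_i\rangle}$ with $$\mathbf V_i=\mathbf U^{(i-1)}-\sum_{j=3}^{i-1}\langle\mathbf U^{(i-1)},\mathbf U_j\rangle\mathbf U_j-\langle\mathbf U^{(i-1)},\mathbf U_0\rangle\mathbf U_2-\langle\mathbf U^{(i-1)},\mathbf U_1\rangle\mathbf U_1-\langle\mathbf U^{(i-1)},\mathbf U_2\rangle\mathbf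 U_0 .$$ (So $\mathbf U_{n+1}$ is the unit tractor orthogonal to $\mathbf U_0,\dots,\mathbf U_n$ on the same side of their span as $\mathbf U^{(n)}$.) The higher conformal curvatures are $K_i=\langle\frac{d}{ds}\mathbf U_{i+1},\mathbf U_{i+2}\rangle$ for $i=2,\dots,n-1$. Then, for an arbitrary regular parametrization of a generic curve, at each point of the curve and for each $i=2,\dots,n-1$, $$K_i=\frac{\sqrt{\Delta_{i+1}\,\Delta_{i+3}}}{-\Delta_{i+2}\,\sqrt[4]{-\Delta_4}},$$ where the right-hand side is computed in the given parametrization (and the left-hand side in the conformal arc-length). This holds in every scale of the conformal class and in every chart of $M$. -/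

import Mathlib

open scoped Manifold ContDiff

noncomputable section

namespace ConformalCurve

/-! ### Conformal structures -/

/-- Smooth Riemannian metrics on the `n`-dimensional manifold `M`. -/
abbrev SmoothMetric (n : ℕ) (M : Type*) [TopologicalSpace M]
    [ChartedSpace (EuclideanSpace ℝ (Fin n)) M] [IsManifold (𝓡 n) ∞ M] : Type _ :=
  Bundle.ContMDiffRiemannianMetric (𝓡 n) ∞ (EuclideanSpace ℝ (Fin n))
    (fun x : M => TangentSpace (𝓡 n) x)

/-- A conformal structure of positive definite signature: a class of Riemannian metrics
that consists of all the positive smooth multiples of any one of its members. The members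
are the scales of the structure. -/
structure ConformalStructure (n : ℕ) (M : Type*) [TopologicalSpace M]
    [ChartedSpace (EuclideanSpace ℝ (Fin n)) M] [IsManifold (𝓡 n) ∞ M] where
  /-- the metrics of the class -/
  metrics : Set (SmoothMetric n M)
  nonempty : metrics.Nonempty
  mem_iff : ∀ g ∈ metrics, ∀ h : SmoothMetric n M,
    h ∈ metrics ↔ ∃ f : M → ℝ, ContMDiff (𝓡 n) 𝓘(ℝ, ℝ) ∞ f ∧ (∀ x, 0 < f x) ∧
      ∀ (x : M) (v w : TangentSpace (𝓡 n) x), h.inner x v w = f x * g.inner x v w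

/-- The coefficients `g_ij = g(∂_i, ∂_j)` of a metric in the chart `φ`, as functions on the
target of `φ`. -/
def metricCoeff {n : ℕ} {M : Type*} [TopologicalSpace M]
    [ChartedSpace (EuclideanSpace ℝ (Fin n)) M] [IsManifold (𝓡 n) ∞ M]
    (g : SmoothMetric n M) (φ : OpenPartialHomeomorph M (EuclideanSpace ℝ (Fin n)))
    (y : EuclideanSpace ℝ (Fin n)) : Matrix (Fin n) (Fin n) ℝ :=
  Matrix.of fun i j =>
    g.inner (φ.symm y)
      (mfderiv (𝓡 n) (𝓡 n) φ.symm y (EuclideanSpace.single i (1 : ℝ)))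
      (mfderiv (𝓡 n) (𝓡 n) φ.symm y (EuclideanSpace.single j (1 : ℝ)))

/-! ### Levi-Civita connection and Schouten tensor in coordinates

In this part `G` is the matrix of the coefficients of a metric on a domain of `ℝⁿ`. -/

/-- The partial derivative `∂_i f`. -/
def pd {n : ℕ} (i : Fin n) (f : EuclideanSpace ℝ (Fin n) → ℝ)
    (y : EuclideanSpace ℝ (Fin n)) : ℝ :=
  fderiv ℝ f y (EuclideanSpace.single i (1 : ℝ))

/-- The Christoffel symbols `Γ^k_ij` of the Levi-Civita connection. -/
def christoffel {n : ℕ} (G : EuclideanSpace ℝ (Fin n) → Matrix (Fin n) (Fin n) ℝ)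
    (k i j : Fin n) (y : EuclideanSpace ℝ (Fin n)) : ℝ :=
  (1 / 2 : ℝ) * ∑ l, (G y)⁻¹ k l *
    (pd i (fun z => G z j l) y + pd j (fun z => G z i l) y - pd l (fun z => G z i j) y)

/-- The Ricci tensor `R_jk` (positive on round spheres). -/
def ricci {n : ℕ} (G : EuclideanSpace ℝ (Fin n) → Matrix (Fin n) (Fin n) ℝ)
    (j k : Fin n) (y : EuclideanSpace ℝ (Fin n)) : ℝ :=
  ∑ i, (pd i (christoffel G i j k) y - pd j (christoffel G i i k) y
    + ∑ l, (christoffel G i i l y * christoffel G l j k y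
      - christoffel G i j l y * christoffel G l i k y))

/-- The scalar curvature. -/
def scalarCurv {n : ℕ} (G : EuclideanSpace ℝ (Fin n) → Matrix (Fin n) (Fin n) ℝ)
    (y : EuclideanSpace ℝ (Fin n)) : ℝ :=
  ∑ j, ∑ k, (G y)⁻¹ j k * ricci G j k y

/-- The Schouten tensor `P_ij = (R_ij - S g_ij / (2 (n - 1))) / (n - 2)`. -/
def schouten {n : ℕ} (G : EuclideanSpace ℝ (Fin n) → Matrix (Fin n) (Fin n) ℝ)
    (i j : Fin n) (y : EuclideanSpace ℝ (Fin n)) : ℝ :=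
  (ricci G i j y - scalarCurv G y / (2 * ((n : ℝ) - 1)) * G y i j) / ((n : ℝ) - 2)

/-! ### Standard tractors along a curve

In a scale and in coordinates, a standard tractor is a triple `(σ, μ, ρ)` with `σ, ρ ∈ ℝ`
(the weights of the densities being trivialised by the scale) and `μ` a tangent vector.
`c` is a parametrized curve in the coordinate domain. -/

/-- The fibre `ℝ ⊕ ℝⁿ ⊕ ℝ` of the standard tractor bundle in a scale and a chart. -/
abbrev Tractor (n : ℕ) : Type := ℝ × (Fin n → ℝ) × ℝ

/-- The tractor metric `⟨(σ, μ, ρ), (τ, ν, π)⟩ = g(μ, ν) + σ π + ρ τ` at the point `y`. -/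
def tractorInner {n : ℕ} (G : EuclideanSpace ℝ (Fin n) → Matrix (Fin n) (Fin n) ℝ)
    (y : EuclideanSpace ℝ (Fin n)) (V W : Tractor n) : ℝ :=
  (∑ i, ∑ j, G y i j * V.2.1 i * W.2.1 j) + V.1 * W.2.2 + V.2.2 * W.1

/-- The tangent vector `U^k` of the parametrized curve `c`. -/
def velocity {n : ℕ} (c : ℝ → EuclideanSpace ℝ (Fin n)) (t : ℝ) (k : Fin n) : ℝ :=
  deriv (fun τ => c τ k) t

/-- The density `u = √(U_c U^c)`. -/
def speed {n : ℕ} (G : EuclideanSpace ℝ (Fin n) → Matrix (Fin n) (Fin n) ℝ)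
    (c : ℝ → EuclideanSpace ℝ (Fin n)) (t : ℝ) : ℝ :=
  Real.sqrt (∑ i, ∑ j, G (c t) i j * velocity c t i * velocity c t j)

/-- The derivative `U^a ∇_a V` of a tractor field `V = (σ, μ, ρ)` along the curve with respect
to the standard tractor connection
`∇_a (σ, μ^b, ρ) = (∇_a σ - μ_a, ∇_a μ^b + δ_a^b ρ + P_a^b σ, ∇_a ρ - P_ac μ^c)`. -/
def tractorDeriv {n : ℕ} (G : EuclideanSpace ℝ (Fin n) → Matrix (Fin n) (Fin n) ℝ)
    (c : ℝ → EuclideanSpace ℝ (Fin n)) (V : ℝ → Tractor n) (t : ℝ) : Tractor n :=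
  (deriv (fun τ => (V τ).1) t - ∑ i, ∑ j, G (c t) i j * velocity c t i * (V t).2.1 j,
   fun k => deriv (fun τ => (V τ).2.1 k) t
      + (∑ i, ∑ j, christoffel G k i j (c t) * velocity c t i * (V t).2.1 j)
      + (V t).2.2 * velocity c t k
      + (V t).1 * ∑ i, ∑ l, (G (c t))⁻¹ k l * schouten G i l (c t) * velocity c t i,
   deriv (fun τ => (V τ).2.2) t
      - ∑ i, ∑ j, schouten G i j (c t) * velocity c t i * (V t).2.1 j)

/-- The sequence `T, U, U', U'', …` of the derived tractors: `T = (0, 0, u⁻¹)` has index `0`,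
and `U^(i)` has index `i + 1`. -/
def derivedTractor {n : ℕ} (G : EuclideanSpace ℝ (Fin n) → Matrix (Fin n) (Fin n) ℝ)
    (c : ℝ → EuclideanSpace ℝ (Fin n)) : ℕ → ℝ → Tractor n
  | 0 => fun t => (0, 0, (speed G c t)⁻¹)
  | k + 1 => tractorDeriv G c (derivedTractor G c k)

/-- The determinant `Δ_j` of the Gram matrix of the first `j` derived tractors. -/
def gramDelta {n : ℕ} (G : EuclideanSpace ℝ (Fin n) → Matrix (Fin n) (Fin n) ℝ)
    (c : ℝ → EuclideanSpace ℝ (Fin n)) (j : ℕ) (t : ℝ) : ℝ :=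
  (Matrix.of fun a b : Fin j =>
    tractorInner G (c t) (derivedTractor G c a t) (derivedTractor G c b t)).det

/-- `Φ = ⟨U'', U''⟩ - ⟨U', U'⟩²`; the conformal arc-length `s` is given by `ds = Φ^(1/4) dt`. -/
def arcDensity {n : ℕ} (G : EuclideanSpace ℝ (Fin n) → Matrix (Fin n) (Fin n) ℝ)
    (c : ℝ → EuclideanSpace ℝ (Fin n)) (t : ℝ) : ℝ :=
  tractorInner G (c t) (derivedTractor G c 3 t) (derivedTractor G c 3 t)
    - tractorInner G (c t) (derivedTractor G c 2 t) (derivedTractor G c 2 t) ^ 2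

/-- The tractor Frenet frame `U_0, …, U_{n+1}` of a curve parametrized by the conformal
arc-length: `U_0 = T`, `U_1 = U`, `U_2 = -U' - ½⟨U', U'⟩ T`, and for `i ≥ 3` the tractor `U_i`
is the normalization `V_i / √⟨V_i, V_i⟩` of
`V_i = U^(i-1) - ∑_{3 ≤ j < i} ⟨U^(i-1), U_j⟩ U_j - ⟨U^(i-1), U_0⟩ U_2 - ⟨U^(i-1), U_1⟩ U_1
- ⟨U^(i-1), U_2⟩ U_0`. For `i = n + 1` this is the unit tractor orthogonal to `U_0, …, U_n`
that lies on the same side of their span as `U^(n)`. -/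
def frenetFrame {n : ℕ} (G : EuclideanSpace ℝ (Fin n) → Matrix (Fin n) (Fin n) ℝ)
    (c : ℝ → EuclideanSpace ℝ (Fin n)) (i : ℕ) (t : ℝ) : Tractor n :=
  match i with
  | 0 => derivedTractor G c 0 t
  | 1 => derivedTractor G c 1 t
  | 2 => -derivedTractor G c 2 t
      - ((1 / 2 : ℝ) * tractorInner G (c t) (derivedTractor G c 2 t) (derivedTractor G c 2 t))
        • derivedTractor G c 0 t
  | m + 3 =>
    let D : Tractor n := derivedTractor G c (m + 3) t
    let V : Tractor n := D
      - ∑ j : Fin m, tractorInner G (c t) D (frenetFrame G c (j + 3) t)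
          • frenetFrame G c (j + 3) t
      - tractorInner G (c t) D (frenetFrame G c 0 t) • frenetFrame G c 2 t
      - tractorInner G (c t) D (frenetFrame G c 1 t) • frenetFrame G c 1 t
      - tractorInner G (c t) D (frenetFrame G c 2 t) • frenetFrame G c 0 t
    (Real.sqrt (tractorInner G (c t) V V))⁻¹ • V
termination_by i
decreasing_by all_goals omega

/-- The higher conformal curvature `K_i = ⟨U_{i+1}', U_{i+2}⟩`, `2 ≤ i ≤ n - 1`, of a curve
parametrized by the conformal arc-length. -/
def higherCurvature {n : ℕ} (G : EuclideanSpace ℝ (Fin n) → Matrix (Fin n) (Fin n) ℝ)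
    (c : ℝ → EuclideanSpace ℝ (Fin n)) (i : ℕ) (s : ℝ) : ℝ :=
  tractorInner G (c s) (tractorDeriv G c (frenetFrame G c (i + 1)) s)
    (frenetFrame G c (i + 2) s)

end ConformalCurve

end

/-! Write `D_0, D_1, …` for the derived tractors `T, U, U', …`. The Frenet vector `V_k` (`k ≥ 3`) is
`D_k` plus a combination of `D_0, …, D_{k-1}`, and it is orthogonal to all of these. Hence `Δ_{k+1}
= Δ_k ⟨V_k, V_k⟩`. The tractor derivative moves the flag spanned by the `D_k` up by one step, so the
part of `U_k'` outside the span of `D_0, …, D_k` is `|V_k|⁻¹ D_{k+1}`. Pairing with `U_{k+1}` gives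
`⟨U_k', U_{k+1}⟩ = |V_{k+1}| / |V_k|`. Since all `Δ_j` with `3 ≤ j` are negative, this is `√(Δ_k
Δ_{k+2}) / (-Δ_{k+1})` (`IsRegularCurve.higherCurvature_eq`), in any parametrization for which the
frame is formed.

The signs come from `Δ_3 = -1` and from positivity: a tractor orthogonal to `T` has no first slot,
so its square is `g(μ, μ) ≥ 0`. Genericity makes the `Δ_j` nonzero (`gramDelta_ne_zero`), so every
`⟨V_k, V_k⟩` is strictly positive.

Under a change of parameter with `ds = f dt`, `D_k` becomes `f^(1-k) D_k` modulo lower terms, so the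
Gram determinants only acquire powers of `f` (`IsReparametrization.gramDelta_eq`). In the quotient
for `K_i` these powers cancel down to `f⁻¹`. For the conformal arc-length `f = Φ^(1/4) =
(-Δ_4)^(1/4)`, which is the extra factor in the denominator.

Beyond smoothness and linear algebra, the one geometric input is that the tractor connection
preserves the tractor metric (`hasDerivAt_tractorInner`). -/

noncomputable section

namespace ConformalCurve

section

variable {n : ℕ} {G : EuclideanSpace ℝ (Fin n) → Matrix (Fin n) (Fin n) ℝ}
  {c : ℝ → EuclideanSpace ℝ (Fin n)}

/-! ### Regular curves in a coordinate domain -/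

/-- `c` is a smooth regular curve on the open set `J` of parameters, and `G` is the coefficient
matrix of a Riemannian metric that is smooth along `c`. -/
structure IsRegularCurve (G : EuclideanSpace ℝ (Fin n) → Matrix (Fin n) (Fin n) ℝ)
    (c : ℝ → EuclideanSpace ℝ (Fin n)) (J : Set ℝ) : Prop where
  isOpen : IsOpen J
  symm : ∀ y i j, G y i j = G y j i
  posDef : ∀ t ∈ J, (G (c t)).PosDef
  smooth_metric : ∀ t ∈ J, ∀ i j, ContDiffAt ℝ ∞ (fun z => G z i j) (c t)
  smooth : ∀ t ∈ J, ContDiffAt ℝ ∞ c t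
  velocity_ne : ∀ t ∈ J, velocity c t ≠ 0

/-- The tractor metric as a bilinear form. -/
def tractorForm (G : EuclideanSpace ℝ (Fin n) → Matrix (Fin n) (Fin n) ℝ)
    (y : EuclideanSpace ℝ (Fin n)) : LinearMap.BilinForm ℝ (Tractor n) :=
  LinearMap.mk₂ ℝ (tractorInner G y)
    (fun V V' W => by
      simp only [tractorInner, Prod.fst_add, Prod.snd_add, Pi.add_apply, mul_add, add_mul,
        Finset.sum_add_distrib]
      ring)
    (fun a V W => by
      simp only [tractorInner, Prod.smul_fst, Prod.smul_snd, Pi.smul_apply, smul_eq_mul, mul_add,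
        Finset.mul_sum]
      congr 1
      · congr 1
        · exact Finset.sum_congr rfl fun i _ => Finset.sum_congr rfl fun j _ => by ring
        · ring
      · ring)
    (fun V W W' => by
      simp only [tractorInner, Prod.fst_add, Prod.snd_add, Pi.add_apply, mul_add,
        Finset.sum_add_distrib]
      ring)
    (fun a V W => by
      simp only [tractorInner, Prod.smul_fst, Prod.smul_snd, Pi.smul_apply, smul_eq_mul, mul_add,
        Finset.mul_sum]
      congr 1
      · congr 1
        · exact Finset.sum_congr rfl fun i _ => Finset.sum_congr rfl fun j _ => by ring
        · ring
      · ring)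

theorem tractorInner_eq (y : EuclideanSpace ℝ (Fin n)) (V W : Tractor n) :
    tractorInner G y V W = tractorForm G y V W := rfl

theorem tractorInner_comm (hG : ∀ y i j, G y i j = G y j i) (y : EuclideanSpace ℝ (Fin n))
    (V W : Tractor n) : tractorInner G y V W = tractorInner G y W V := by
  unfold tractorInner
  rw [Finset.sum_comm]
  have : ∑ j, ∑ i, G y i j * V.2.1 i * W.2.1 j = ∑ j, ∑ i, G y j i * W.2.1 j * V.2.1 i :=
    Finset.sum_congr rfl fun i _ => Finset.sum_congr rfl fun j _ => by rw [hG y j i]; ring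
  rw [this]
  ring

theorem tractorForm_comm (hG : ∀ y i j, G y i j = G y j i) (y : EuclideanSpace ℝ (Fin n))
    (V W : Tractor n) : tractorForm G y V W = tractorForm G y W V :=
  tractorInner_comm hG y V W

/-! ### The tractor connection preserves the tractor metric -/

theorem sum_mul_inv_mul {ι : Type*} [Fintype ι] [DecidableEq ι] (A : Matrix ι ι ℝ)
    (hA : IsUnit A.det) (X : ι → ℝ) (j : ι) : ∑ i, A j i * ∑ l, A⁻¹ i l * X l = X j := by
  have h : A.mulVec (A⁻¹.mulVec X) = X := by
    rw [Matrix.mulVec_mulVec, Matrix.mul_nonsing_inv A hA, Matrix.one_mulVec]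
  exact congrFun h j

/-- The first kind Christoffel symbols, contracted with three vectors. -/
def christoffelForm (G : EuclideanSpace ℝ (Fin n) → Matrix (Fin n) (Fin n) ℝ)
    (y : EuclideanSpace ℝ (Fin n)) (X Y Z : Fin n → ℝ) : ℝ :=
  ∑ a, ∑ b, ∑ m, (1 / 2 : ℝ) * X a * Y b * Z m * (pd a (fun z => G z b m) y
    + pd b (fun z => G z a m) y - pd m (fun z => G z a b) y)

/-- Metric compatibility of the Levi-Civita connection: in the sum over both orders of `Y` and `Z`
the last two partial derivatives cancel and the first one doubles. -/
theorem christoffelForm_add (hG : ∀ y i j, G y i j = G y j i) (y : EuclideanSpace ℝ (Fin n))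
    (X Y Z : Fin n → ℝ) : christoffelForm G y X Y Z + christoffelForm G y X Z Y =
      ∑ b, ∑ m, (∑ a, pd a (fun z => G z b m) y * X a) * Y b * Z m := by
  have h1 : christoffelForm G y X Z Y = ∑ a, ∑ b, ∑ m, (1 / 2 : ℝ) * X a * Z m * Y b *
      (pd a (fun z => G z m b) y + pd m (fun z => G z a b) y - pd b (fun z => G z a m) y) := by
    unfold christoffelForm
    exact Finset.sum_congr rfl fun a _ => Finset.sum_comm
  have h2 : ∑ b, ∑ m, (∑ a, pd a (fun z => G z b m) y * X a) * Y b * Z m =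
      ∑ a, ∑ b, ∑ m, pd a (fun z => G z b m) y * X a * Y b * Z m := by
    simp only [Finset.sum_mul]
    rw [Finset.sum_comm]
    rw [Finset.sum_congr rfl fun m _ => Finset.sum_comm]
    rw [Finset.sum_comm]
    rw [Finset.sum_congr rfl fun a _ => Finset.sum_comm]
  rw [h1, h2, christoffelForm]
  simp only [← Finset.sum_add_distrib]
  refine Finset.sum_congr rfl fun a _ => Finset.sum_congr rfl fun b _ =>
    Finset.sum_congr rfl fun m _ => ?_
  have : (fun z => G z m b) = fun z => G z b m := funext fun z => hG z m b
  rw [this]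
  ring

theorem sum_metric_mul_christoffel (y : EuclideanSpace ℝ (Fin n)) (hy : IsUnit (G y).det)
    (a b j : Fin n) : ∑ i, G y j i * christoffel G i a b y = (1 / 2 : ℝ) *
      (pd a (fun z => G z b j) y + pd b (fun z => G z a j) y - pd j (fun z => G z a b) y) := by
  have := sum_mul_inv_mul (G y) hy (fun l => pd a (fun z => G z b l) y
    + pd b (fun z => G z a l) y - pd l (fun z => G z a b) y) j
  rw [← this, Finset.mul_sum]
  exact Finset.sum_congr rfl fun i _ => by unfold christoffel; ring

/-- Lowering the index removes the inverse metric from the Christoffel and Schouten terms. In this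
form the last four terms are visibly skew under the exchange of `V t` and `W`. -/
theorem tractorInner_tractorDeriv (hG : ∀ y i j, G y i j = G y j i) (V : ℝ → Tractor n)
    (t : ℝ) (hdet : IsUnit (G (c t)).det) (W : Tractor n) :
    tractorInner G (c t) (tractorDeriv G c V t) W =
      tractorInner G (c t) (deriv (fun τ => (V τ).1) t, fun k => deriv (fun τ => (V τ).2.1 k) t,
        deriv (fun τ => (V τ).2.2) t) W
      + christoffelForm G (c t) (velocity c t) (V t).2.1 W.2.1
      + (V t).2.2 * (∑ i, ∑ j, G (c t) i j * velocity c t i * W.2.1 j)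
      - (∑ i, ∑ j, G (c t) i j * velocity c t i * (V t).2.1 j) * W.2.2
      + (V t).1 * (∑ i, ∑ j, schouten G i j (c t) * velocity c t i * W.2.1 j)
      - (∑ i, ∑ j, schouten G i j (c t) * velocity c t i * (V t).2.1 j) * W.1 := by
  have e1 : ∑ i, ∑ j, G (c t) i j * (∑ a, ∑ b, christoffel G i a b (c t) * velocity c t a *
      (V t).2.1 b) * W.2.1 j = christoffelForm G (c t) (velocity c t) (V t).2.1 W.2.1 := by
    have : ∀ a b m, (1 / 2 : ℝ) * velocity c t a * (V t).2.1 b * W.2.1 m *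
        (pd a (fun z => G z b m) (c t) + pd b (fun z => G z a m) (c t)
          - pd m (fun z => G z a b) (c t)) =
        ∑ i, G (c t) i m * (christoffel G i a b (c t) * velocity c t a * (V t).2.1 b)
          * W.2.1 m := by
      intro a b m
      have h := sum_metric_mul_christoffel (c t) hdet a b m
      calc _ = velocity c t a * (V t).2.1 b * W.2.1 m * ((1 / 2 : ℝ) *
        (pd a (fun z => G z b m) (c t) + pd b (fun z => G z a m) (c t)
          - pd m (fun z => G z a b) (c t))) := by ring
        _ = _ := by
          rw [← h, Finset.mul_sum]
          exact Finset.sum_congr rfl fun i _ => by rw [hG _ m i]; ring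
    unfold christoffelForm
    simp only [this, Finset.mul_sum, Finset.sum_mul]
    rw [Finset.sum_comm]
    calc _ = ∑ m, ∑ a, ∑ i, ∑ b, G (c t) i m * (christoffel G i a b (c t) * velocity c t a *
          (V t).2.1 b) * W.2.1 m := Finset.sum_congr rfl fun m _ => Finset.sum_comm
      _ = ∑ a, ∑ m, ∑ i, ∑ b, G (c t) i m * (christoffel G i a b (c t) * velocity c t a *
          (V t).2.1 b) * W.2.1 m := Finset.sum_comm
      _ = ∑ a, ∑ m, ∑ b, ∑ i, G (c t) i m * (christoffel G i a b (c t) * velocity c t a *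
          (V t).2.1 b) * W.2.1 m := Finset.sum_congr rfl fun a _ =>
            Finset.sum_congr rfl fun m _ => Finset.sum_comm
      _ = _ := Finset.sum_congr rfl fun a _ => Finset.sum_comm
  have e2 : ∑ i, ∑ j, G (c t) i j * (∑ a, ∑ l, (G (c t))⁻¹ i l * schouten G a l (c t) *
      velocity c t a) * W.2.1 j = ∑ i, ∑ j, schouten G i j (c t) * velocity c t i * W.2.1 j := by
    rw [Finset.sum_comm, Finset.sum_comm (f := fun i j =>
      schouten G i j (c t) * velocity c t i * W.2.1 j)]
    refine Finset.sum_congr rfl fun j _ => ?_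
    have h := sum_mul_inv_mul (G (c t)) hdet
      (fun l => ∑ a, schouten G a l (c t) * velocity c t a) j
    rw [← Finset.sum_mul, ← Finset.sum_mul, ← h]
    congr 1
    refine Finset.sum_congr rfl fun i _ => ?_
    rw [hG _ i j, Finset.sum_comm]
    simp only [Finset.mul_sum, mul_assoc]
  unfold tractorDeriv tractorInner
  simp only [mul_add, add_mul, Finset.sum_add_distrib]
  have hs : ∀ (a : ℝ) (X : Fin n → ℝ), ∑ i, ∑ j, G (c t) i j * (a * X i) * W.2.1 j =
      a * ∑ i, ∑ j, G (c t) i j * X i * W.2.1 j := fun a X => by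
    simp only [Finset.mul_sum]
    exact Finset.sum_congr rfl fun i _ => Finset.sum_congr rfl fun j _ => by ring
  rw [e1, hs, hs, e2]
  ring

theorem hasDerivAt_component {c : ℝ → EuclideanSpace ℝ (Fin n)} {t : ℝ}
    (hc : DifferentiableAt ℝ c t) (k : Fin n) :
    HasDerivAt (fun τ => c τ k) (velocity c t k) t := by
  have : DifferentiableAt ℝ (fun τ => c τ k) t :=
    (differentiableAt_euclidean.1 hc) k
  exact this.hasDerivAt

theorem deriv_eq_sum_velocity {t : ℝ} (hc : DifferentiableAt ℝ c t) :
    deriv c t = ∑ k, velocity c t k • EuclideanSpace.single k (1 : ℝ) := by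
  ext k
  have h := (EuclideanSpace.proj (𝕜 := ℝ) k).hasFDerivAt.comp_hasDerivAt t hc.hasDerivAt
  have h' := h.unique (hasDerivAt_component hc k)
  simp at h'
  simp [h', Pi.single_apply]

theorem hasDerivAt_comp_curve {f : EuclideanSpace ℝ (Fin n) → ℝ} {t : ℝ}
    (hf : DifferentiableAt ℝ f (c t)) (hc : DifferentiableAt ℝ c t) :
    HasDerivAt (fun τ => f (c τ)) (∑ k, pd k f (c t) * velocity c t k) t := by
  have h := hf.hasFDerivAt.comp_hasDerivAt t hc.hasDerivAt
  rw [deriv_eq_sum_velocity hc, map_sum] at h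
  simp only [map_smul, smul_eq_mul, mul_comm (velocity c t _)] at h
  exact h

theorem hasDerivAt_tractorInner {J : Set ℝ} (h : IsRegularCurve G c J) {V W : ℝ → Tractor n}
    {t : ℝ} (ht : t ∈ J) (hV : DifferentiableAt ℝ V t) (hW : DifferentiableAt ℝ W t) :
    HasDerivAt (fun τ => tractorInner G (c τ) (V τ) (W τ))
      (tractorInner G (c t) (tractorDeriv G c V t) (W t)
        + tractorInner G (c t) (V t) (tractorDeriv G c W t)) t := by
  have hdet : IsUnit (G (c t)).det := (h.posDef t ht).det_pos.ne'.isUnit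
  have hc : DifferentiableAt ℝ c t := (h.smooth t ht).differentiableAt (by simp)
  have hV2 := differentiableAt_pi.1 hV.snd.fst
  have hW2 := differentiableAt_pi.1 hW.snd.fst
  rw [tractorInner_comm h.symm (c t) (V t), tractorInner_tractorDeriv h.symm V t hdet,
    tractorInner_tractorDeriv h.symm W t hdet]
  have hd : HasDerivAt (fun τ => tractorInner G (c τ) (V τ) (W τ))
      ((∑ i, ∑ j, (((∑ k, pd k (fun z => G z i j) (c t) * velocity c t k) * (V t).2.1 i
        + G (c t) i j * deriv (fun τ => (V τ).2.1 i) t) * (W t).2.1 j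
        + G (c t) i j * (V t).2.1 i * deriv (fun τ => (W τ).2.1 j) t))
      + (deriv (fun τ => (V τ).1) t * (W t).2.2 + (V t).1 * deriv (fun τ => (W τ).2.2) t)
      + (deriv (fun τ => (V τ).2.2) t * (W t).1 + (V t).2.2 * deriv (fun τ => (W τ).1) t)) t := by
    unfold tractorInner
    refine ((HasDerivAt.fun_sum fun i _ => HasDerivAt.fun_sum fun j _ => ?_).add ?_).add ?_
    · exact ((hasDerivAt_comp_curve ((h.smooth_metric t ht i j).differentiableAt (by simp))
        hc).mul (hV2 i).hasDerivAt).mul (hW2 j).hasDerivAt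
    · exact hV.fst.hasDerivAt.mul hW.snd.snd.hasDerivAt
    · exact hV.snd.snd.hasDerivAt.mul hW.fst.hasDerivAt
  convert hd using 1
  -- The skew terms cancel in the sum, for any tensor in place of `schouten`. What remains of the
  -- connection is the symmetrized Christoffel form, which is the derivative of the metric
  -- coefficients along the curve.
  have hC := christoffelForm_add h.symm (c t) (velocity c t) (V t).2.1 (W t).2.1
  have hsum : (∑ i, ∑ j, (((∑ k, pd k (fun z => G z i j) (c t) * velocity c t k) * (V t).2.1 i
        + G (c t) i j * deriv (fun τ => (V τ).2.1 i) t) * (W t).2.1 j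
        + G (c t) i j * (V t).2.1 i * deriv (fun τ => (W τ).2.1 j) t)) =
      christoffelForm G (c t) (velocity c t) (V t).2.1 (W t).2.1
      + christoffelForm G (c t) (velocity c t) (W t).2.1 (V t).2.1
      + (∑ i, ∑ j, G (c t) i j * deriv (fun τ => (V τ).2.1 i) t * (W t).2.1 j)
      + (∑ i, ∑ j, G (c t) i j * deriv (fun τ => (W τ).2.1 i) t * (V t).2.1 j) := by
    rw [hC, Finset.sum_comm (f := fun i j =>
      G (c t) i j * deriv (fun τ => (W τ).2.1 i) t * (V t).2.1 j)]
    simp only [← Finset.sum_add_distrib]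
    refine Finset.sum_congr rfl fun i _ => Finset.sum_congr rfl fun j _ => ?_
    rw [h.symm _ j i]
    ring
  rw [hsum]
  unfold tractorInner
  ring

/-! ### Smoothness -/

theorem contDiffAt_pd {i : Fin n} {f : EuclideanSpace ℝ (Fin n) → ℝ}
    {y : EuclideanSpace ℝ (Fin n)} (hf : ContDiffAt ℝ ∞ f y) : ContDiffAt ℝ ∞ (pd i f) y :=
  (hf.fderiv_right (m := ∞) (by simp)).clm_apply contDiffAt_const

theorem contDiffAt_deriv {F : Type*} [NormedAddCommGroup F] [NormedSpace ℝ F] {f : ℝ → F}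
    {t : ℝ} (hf : ContDiffAt ℝ ∞ f t) : ContDiffAt ℝ ∞ (deriv f) t :=
  (hf.fderiv_right (m := ∞) (by simp)).clm_apply contDiffAt_const

theorem contDiffAt_det {E ι : Type*} [NormedAddCommGroup E] [NormedSpace ℝ E] [Fintype ι]
    [DecidableEq ι] {A : E → Matrix ι ι ℝ} {y : E}
    (hA : ∀ i j, ContDiffAt ℝ ∞ (fun z => A z i j) y) :
    ContDiffAt ℝ ∞ (fun z => (A z).det) y := by
  simp only [Matrix.det_apply]
  exact ContDiffAt.sum fun σ _ => (contDiffAt_prod fun i _ => hA _ _).const_smul _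

/-- Cramer's rule: each entry is a determinant with one row replaced by constants, divided by `det
A`. -/
theorem contDiffAt_inv_matrix {E ι : Type*} [NormedAddCommGroup E] [NormedSpace ℝ E] [Fintype ι]
    [DecidableEq ι] {A : E → Matrix ι ι ℝ} {y : E}
    (hA : ∀ i j, ContDiffAt ℝ ∞ (fun z => A z i j) y) (hy : (A y).det ≠ 0) (i j : ι) :
    ContDiffAt ℝ ∞ (fun z => (A z)⁻¹ i j) y := by
  simp only [Matrix.inv_def, Ring.inverse_eq_inv', Matrix.smul_apply, smul_eq_mul,
    Matrix.adjugate_apply]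
  refine ((contDiffAt_det hA).inv hy).mul (contDiffAt_det fun k l => ?_)
  by_cases hk : k = j
  · subst hk
    simpa using contDiffAt_const
  · simpa [Matrix.updateRow_ne hk] using hA k l

section

variable {y : EuclideanSpace ℝ (Fin n)} (hG : ∀ i j, ContDiffAt ℝ ∞ (fun z => G z i j) y)
  (hy : (G y).det ≠ 0)
include hG hy

theorem contDiffAt_christoffel (k i j : Fin n) : ContDiffAt ℝ ∞ (christoffel G k i j) y := by
  unfold christoffel
  exact contDiffAt_const.mul (ContDiffAt.sum fun l _ => (contDiffAt_inv_matrix hG hy k l).mul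
    (((contDiffAt_pd (hG j l)).add (contDiffAt_pd (hG i l))).sub (contDiffAt_pd (hG i j))))

theorem contDiffAt_ricci (j k : Fin n) : ContDiffAt ℝ ∞ (ricci G j k) y := by
  have h := contDiffAt_christoffel hG hy
  unfold ricci
  exact ContDiffAt.sum fun i _ => ((contDiffAt_pd (h i j k)).sub (contDiffAt_pd (h i i k))).add
    (ContDiffAt.sum fun l _ => ((h i i l).mul (h l j k)).sub ((h i j l).mul (h l i k)))

theorem contDiffAt_schouten (i j : Fin n) : ContDiffAt ℝ ∞ (schouten G i j) y := by
  have h := contDiffAt_ricci hG hy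
  have hS : ContDiffAt ℝ ∞ (scalarCurv G) y := by
    unfold scalarCurv
    exact ContDiffAt.sum fun j _ => ContDiffAt.sum fun k _ =>
      (contDiffAt_inv_matrix hG hy j k).mul (h j k)
  unfold schouten
  exact ((h i j).sub ((hS.div_const _).mul (hG i j))).div_const _

end

end

/-! ### Smoothness along a curve, the flag of derived tractors and Gram determinants -/

section

variable {n : ℕ} {G : EuclideanSpace ℝ (Fin n) → Matrix (Fin n) (Fin n) ℝ}
  {c : ℝ → EuclideanSpace ℝ (Fin n)} {J : Set ℝ}

theorem contDiffAt_tractor {V : ℝ → Tractor n} {t : ℝ}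
    (h1 : ContDiffAt ℝ ∞ (fun τ => (V τ).1) t)
    (h2 : ∀ k, ContDiffAt ℝ ∞ (fun τ => (V τ).2.1 k) t)
    (h3 : ContDiffAt ℝ ∞ (fun τ => (V τ).2.2) t) : ContDiffAt ℝ ∞ V t :=
  h1.prodMk ((contDiffAt_pi.2 h2).prodMk h3)

theorem contDiffAt_coord {V : ℝ → Tractor n} {t : ℝ} (hV : ContDiffAt ℝ ∞ V t) (k : Fin n) :
    ContDiffAt ℝ ∞ (fun τ => (V τ).2.1 k) t :=
  contDiffAt_pi.1 hV.snd.fst k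

theorem sum_pos_of_posDef {A : Matrix (Fin n) (Fin n) ℝ} (hA : A.PosDef) {v : Fin n → ℝ}
    (hv : v ≠ 0) : 0 < ∑ i, ∑ j, A i j * v i * v j := by
  have h := hA.dotProduct_mulVec_pos hv
  simp only [dotProduct, Matrix.mulVec, star_trivial, Finset.mul_sum] at h
  refine h.trans_eq (Finset.sum_congr rfl fun i _ => Finset.sum_congr rfl fun j _ => by ring)

namespace IsRegularCurve

variable (h : IsRegularCurve G c J) {t : ℝ} (ht : t ∈ J)
include h ht

theorem speed_pos : 0 < speed G c t :=
  Real.sqrt_pos.2 (sum_pos_of_posDef (h.posDef t ht) (h.velocity_ne t ht))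

theorem speed_sq : ∑ i, ∑ j, G (c t) i j * velocity c t i * velocity c t j = speed G c t ^ 2 :=
  (Real.sq_sqrt (sum_pos_of_posDef (h.posDef t ht) (h.velocity_ne t ht)).le).symm

theorem contDiffAt_metric (i j : Fin n) : ContDiffAt ℝ ∞ (fun τ => G (c τ) i j) t :=
  (h.smooth_metric t ht i j).comp t (h.smooth t ht)

theorem contDiffAt_velocity (k : Fin n) : ContDiffAt ℝ ∞ (fun τ => velocity c τ k) t :=
  contDiffAt_deriv (contDiffAt_euclidean.1 (h.smooth t ht) k)

theorem contDiffAt_speed : ContDiffAt ℝ ∞ (speed G c) t := by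
  unfold speed
  refine ContDiffAt.sqrt (ContDiffAt.sum fun i _ => ContDiffAt.sum fun j _ =>
    ((h.contDiffAt_metric ht i j).mul (h.contDiffAt_velocity ht i)).mul
      (h.contDiffAt_velocity ht j)) ?_
  exact (sum_pos_of_posDef (h.posDef t ht) (h.velocity_ne t ht)).ne'

theorem contDiffAt_tractorInner {V W : ℝ → Tractor n} (hV : ContDiffAt ℝ ∞ V t)
    (hW : ContDiffAt ℝ ∞ W t) :
    ContDiffAt ℝ ∞ (fun τ => tractorInner G (c τ) (V τ) (W τ)) t := by
  unfold tractorInner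
  exact ((ContDiffAt.sum fun i _ => ContDiffAt.sum fun j _ =>
    ((h.contDiffAt_metric ht i j).mul (contDiffAt_coord hV i)).mul (contDiffAt_coord hW j)).add
    (hV.fst.mul hW.snd.snd)).add (hV.snd.snd.mul hW.fst)

theorem contDiffAt_tractorDeriv {V : ℝ → Tractor n} (hV : ContDiffAt ℝ ∞ V t) :
    ContDiffAt ℝ ∞ (tractorDeriv G c V) t := by
  have hdet : (G (c t)).det ≠ 0 := (h.posDef t ht).det_pos.ne'
  have hG := h.smooth_metric t ht
  have hP (i j : Fin n) : ContDiffAt ℝ ∞ (fun τ => schouten G i j (c τ)) t :=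
    (contDiffAt_schouten hG hdet i j).comp t (h.smooth t ht)
  have hΓ (k i j : Fin n) : ContDiffAt ℝ ∞ (fun τ => christoffel G k i j (c τ)) t :=
    (contDiffAt_christoffel hG hdet k i j).comp t (h.smooth t ht)
  have hI (i j : Fin n) : ContDiffAt ℝ ∞ (fun τ => (G (c τ))⁻¹ i j) t :=
    contDiffAt_inv_matrix (h.contDiffAt_metric ht) hdet i j
  have hU := h.contDiffAt_velocity ht
  have hμ := contDiffAt_coord hV
  refine contDiffAt_tractor ?_ (fun k => ?_) ?_
  · exact (contDiffAt_deriv hV.fst).sub (ContDiffAt.sum fun i _ => ContDiffAt.sum fun j _ =>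
      ((h.contDiffAt_metric ht i j).mul (hU i)).mul (hμ j))
  · exact (((contDiffAt_deriv (hμ k)).add (ContDiffAt.sum fun i _ => ContDiffAt.sum fun j _ =>
      ((hΓ k i j).mul (hU i)).mul (hμ j))).add (hV.snd.snd.mul (hU k))).add
      (hV.fst.mul (ContDiffAt.sum fun i _ => ContDiffAt.sum fun l _ =>
        ((hI k l).mul (hP i l)).mul (hU i)))
  · exact (contDiffAt_deriv hV.snd.snd).sub (ContDiffAt.sum fun i _ => ContDiffAt.sum fun j _ =>
      ((hP i j).mul (hU i)).mul (hμ j))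

theorem contDiffAt_derivedTractor (k : ℕ) : ContDiffAt ℝ ∞ (derivedTractor G c k) t := by
  induction k with
  | zero =>
    refine contDiffAt_tractor contDiffAt_const (fun _ => contDiffAt_const) ?_
    exact (h.contDiffAt_speed ht).inv (h.speed_pos ht).ne'
  | succ k ih => exact h.contDiffAt_tractorDeriv ht ih

end IsRegularCurve

/-! ### Derivation rules -/

theorem tractorDeriv_congr {V W : ℝ → Tractor n} {t : ℝ} (hVW : V =ᶠ[nhds t] W) :
    tractorDeriv G c V t = tractorDeriv G c W t := by
  have h1 : deriv (fun τ => (V τ).1) t = deriv (fun τ => (W τ).1) t :=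
    Filter.EventuallyEq.deriv_eq (hVW.mono fun τ h => by simp [h])
  have h2 (k : Fin n) : deriv (fun τ => (V τ).2.1 k) t = deriv (fun τ => (W τ).2.1 k) t :=
    Filter.EventuallyEq.deriv_eq (hVW.mono fun τ h => by simp [h])
  have h3 : deriv (fun τ => (V τ).2.2) t = deriv (fun τ => (W τ).2.2) t :=
    Filter.EventuallyEq.deriv_eq (hVW.mono fun τ h => by simp [h])
  simp only [tractorDeriv, h1, h2, h3, hVW.self_of_nhds]

theorem tractorDeriv_add {V W : ℝ → Tractor n} {t : ℝ} (hV : DifferentiableAt ℝ V t)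
    (hW : DifferentiableAt ℝ W t) : tractorDeriv G c (fun τ => V τ + W τ) t =
      tractorDeriv G c V t + tractorDeriv G c W t := by
  have h1 : deriv (fun τ => (V τ + W τ).1) t = deriv (fun τ => (V τ).1) t +
    deriv (fun τ => (W τ).1) t := deriv_fun_add hV.fst hW.fst
  have h2 (k : Fin n) : deriv (fun τ => (V τ + W τ).2.1 k) t = deriv (fun τ => (V τ).2.1 k) t +
    deriv (fun τ => (W τ).2.1 k) t :=
    deriv_fun_add (differentiableAt_pi.1 hV.snd.fst k) (differentiableAt_pi.1 hW.snd.fst k)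
  have h3 : deriv (fun τ => (V τ + W τ).2.2) t = deriv (fun τ => (V τ).2.2) t +
    deriv (fun τ => (W τ).2.2) t := deriv_fun_add hV.snd.snd hW.snd.snd
  ext k
  · simp only [tractorDeriv]
    rw [h1]
    simp only [Prod.fst_add, Prod.snd_add, Pi.add_apply, mul_add,
      Finset.sum_add_distrib]
    ring
  · simp only [tractorDeriv]
    rw [h2]
    simp only [Prod.fst_add, Prod.snd_add, Pi.add_apply, mul_add,
      Finset.sum_add_distrib]
    ring
  · simp only [tractorDeriv]
    rw [h3]
    simp only [Prod.snd_add, Prod.fst_add, Pi.add_apply, mul_add,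
      Finset.sum_add_distrib]
    ring

theorem tractorDeriv_smul {x : ℝ → ℝ} {V : ℝ → Tractor n} {t : ℝ} (hx : DifferentiableAt ℝ x t)
    (hV : DifferentiableAt ℝ V t) : tractorDeriv G c (fun τ => x τ • V τ) t =
      deriv x t • V t + x t • tractorDeriv G c V t := by
  have h1 : deriv (fun τ => (x τ • V τ).1) t = deriv x t * (V t).1 + x t *
    deriv (fun τ => (V τ).1) t := deriv_fun_mul hx hV.fst
  have h2 (k : Fin n) : deriv (fun τ => (x τ • V τ).2.1 k) t = deriv x t * (V t).2.1 k +
    x t * deriv (fun τ => (V τ).2.1 k) t :=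
    deriv_fun_mul hx (differentiableAt_pi.1 hV.snd.fst k)
  have h3 : deriv (fun τ => (x τ • V τ).2.2) t = deriv x t * (V t).2.2 + x t *
    deriv (fun τ => (V τ).2.2) t := deriv_fun_mul hx hV.snd.snd
  have hs (A : Fin n → Fin n → ℝ) (μ : Fin n → ℝ) : ∑ i, ∑ j, A i j * (x t * μ j) =
      x t * ∑ i, ∑ j, A i j * μ j := by
    simp only [Finset.mul_sum]
    exact Finset.sum_congr rfl fun i _ => Finset.sum_congr rfl fun j _ => by ring
  ext k
  · simp only [tractorDeriv]
    rw [h1]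
    simp only [Prod.smul_fst, Prod.smul_snd, Prod.fst_add, Pi.smul_apply, smul_eq_mul, hs]
    ring
  · simp only [tractorDeriv]
    rw [h2]
    simp only [Prod.smul_fst, Prod.smul_snd, Prod.fst_add, Prod.snd_add,
      Pi.smul_apply, Pi.add_apply, smul_eq_mul, hs]
    ring
  · simp only [tractorDeriv]
    rw [h3]
    simp only [Prod.smul_fst, Prod.smul_snd, Prod.snd_add, Pi.smul_apply, smul_eq_mul, hs]
    ring

/-! ### The filtration by the derived tractors -/

/-- The field `V` is on `J` a combination of the first `k` derived tractors with smooth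
coefficients. -/
def InFlag (G : EuclideanSpace ℝ (Fin n) → Matrix (Fin n) (Fin n) ℝ)
    (c : ℝ → EuclideanSpace ℝ (Fin n)) (J : Set ℝ) (k : ℕ) (V : ℝ → Tractor n) : Prop :=
  ∃ x : ℕ → ℝ → ℝ, (∀ b, ∀ t ∈ J, ContDiffAt ℝ ∞ (x b) t) ∧
    ∀ t ∈ J, V t = ∑ b ∈ Finset.range k, x b t • derivedTractor G c b t

namespace InFlag

variable {V W : ℝ → Tractor n} {k l : ℕ}

theorem congr (hV : InFlag G c J k V) (hW : ∀ t ∈ J, W t = V t) : InFlag G c J k W := by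
  obtain ⟨x, hx, hxV⟩ := hV
  exact ⟨x, hx, fun t ht => by rw [hW t ht, hxV t ht]⟩

theorem mono (hV : InFlag G c J k V) (hkl : k ≤ l) : InFlag G c J l V := by
  obtain ⟨x, hx, hxV⟩ := hV
  -- The given coefficients are arbitrary from index `k` on, so they are cut off to zero there.
  refine ⟨fun b => if b < k then x b else 0, fun b t ht => ?_, fun t ht => ?_⟩
  · beta_reduce
    split_ifs
    · exact hx b t ht
    · exact contDiffAt_const
  · rw [hxV t ht]
    refine Finset.sum_subset_zero_on_sdiff (Finset.range_mono hkl) (fun b hb => ?_)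
      fun b hb => ?_
    · have : ¬ b < k := by simpa using (Finset.mem_sdiff.1 hb).2
      simp [this]
    · simp [Finset.mem_range.1 hb]

theorem zero (k : ℕ) : InFlag G c J k (fun _ => 0) :=
  ⟨0, fun _ _ _ => contDiffAt_const, fun t _ => by simp⟩

theorem add (hV : InFlag G c J k V) (hW : InFlag G c J k W) :
    InFlag G c J k (fun t => V t + W t) := by
  obtain ⟨x, hx, hxV⟩ := hV
  obtain ⟨y, hy, hyW⟩ := hW
  refine ⟨fun b => x b + y b, fun b t ht => (hx b t ht).add (hy b t ht), fun t ht => ?_⟩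
  beta_reduce
  rw [hxV t ht, hyW t ht, ← Finset.sum_add_distrib]
  exact Finset.sum_congr rfl fun b _ => by rw [Pi.add_apply, add_smul]

theorem smul {r : ℝ → ℝ} (hr : ∀ t ∈ J, ContDiffAt ℝ ∞ r t) (hV : InFlag G c J k V) :
    InFlag G c J k (fun t => r t • V t) := by
  obtain ⟨x, hx, hxV⟩ := hV
  refine ⟨fun b t => r t * x b t, fun b t ht => (hr t ht).mul (hx b t ht), fun t ht => ?_⟩
  beta_reduce
  rw [hxV t ht, Finset.smul_sum]
  exact Finset.sum_congr rfl fun b _ => smul_smul _ _ _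

theorem neg (hV : InFlag G c J k V) : InFlag G c J k (fun t => -V t) :=
  (hV.smul (r := fun _ => -1) fun _ _ => contDiffAt_const).congr fun t _ => by simp

theorem sub (hV : InFlag G c J k V) (hW : InFlag G c J k W) :
    InFlag G c J k (fun t => V t - W t) :=
  (hV.add hW.neg).congr fun _ _ => sub_eq_add_neg _ _

theorem sum {ι : Type*} (s : Finset ι) {F : ι → ℝ → Tractor n}
    (hF : ∀ i ∈ s, InFlag G c J k (F i)) : InFlag G c J k (fun t => ∑ i ∈ s, F i t) := by
  classical
  induction s using Finset.induction_on with
  | empty => exact (zero k).congr fun t _ => by simp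
  | insert a s ha ih =>
    refine ((hF a (Finset.mem_insert_self a s)).add
      (ih fun i hi => hF i (Finset.mem_insert_of_mem hi))).congr fun t _ => ?_
    rw [Finset.sum_insert ha]

theorem derivedTractor (hkl : k < l) : InFlag G c J l (derivedTractor G c k) := by
  refine ⟨fun b _ => if b = k then 1 else 0, fun _ _ _ => contDiffAt_const, fun t _ => ?_⟩
  simp [hkl]

theorem contDiffAt (h : IsRegularCurve G c J) (hV : InFlag G c J k V) {t : ℝ} (ht : t ∈ J) :
    ContDiffAt ℝ ∞ V t := by
  obtain ⟨x, hx, hxV⟩ := hV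
  refine ContDiffAt.congr_of_eventuallyEq ?_
    (Filter.eventually_of_mem (h.isOpen.mem_nhds ht) hxV)
  exact ContDiffAt.sum fun b _ => (hx b t ht).smul (h.contDiffAt_derivedTractor ht b)

/-- By the Leibniz rule `x_b D_b` contributes `x_b' D_b + x_b D_{b+1}`, so the flag index rises by
exactly one. -/
theorem tractorDeriv (h : IsRegularCurve G c J) (hV : InFlag G c J k V) :
    InFlag G c J (k + 1) (tractorDeriv G c V) := by
  obtain ⟨x, hx, hxV⟩ := hV
  have hD (b : ℕ) {t : ℝ} (ht : t ∈ J) :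
      DifferentiableAt ℝ (ConformalCurve.derivedTractor G c b) t :=
    (h.contDiffAt_derivedTractor ht b).differentiableAt (by simp)
  have hx' (b : ℕ) {t : ℝ} (ht : t ∈ J) : DifferentiableAt ℝ (x b) t :=
    (hx b t ht).differentiableAt (by simp)
  have key : ∀ t ∈ J, ConformalCurve.tractorDeriv G c V t = ∑ b ∈ Finset.range k,
      (deriv (x b) t • ConformalCurve.derivedTractor G c b t
        + x b t • ConformalCurve.derivedTractor G c (b + 1) t) := by
    intro t ht
    rw [tractorDeriv_congr (Filter.eventually_of_mem (h.isOpen.mem_nhds ht) hxV)]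
    -- The representation of `V` by `k` terms does not pass to smaller `k` and must not enter the
    -- induction.
    clear hxV
    induction k with
    | zero => ext <;> simp [ConformalCurve.tractorDeriv]
    | succ k ih =>
      simp only [Finset.sum_range_succ]
      rw [tractorDeriv_add, ih, tractorDeriv_smul (hx' k ht) (hD k ht)]
      · rfl
      · exact DifferentiableAt.fun_sum fun b _ => (hx' b ht).smul (hD b ht)
      · exact (hx' k ht).smul (hD k ht)
  refine (sum (Finset.range k) fun b hb => ?_).congr key
  have hb := Finset.mem_range.1 hb
  exact ((derivedTractor (by omega)).smul fun t ht => contDiffAt_deriv (hx b t ht)).add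
    ((derivedTractor (by omega)).smul (hx b))

theorem tractorForm_eq_zero (hV : InFlag G c J k V) {t : ℝ} (ht : t ∈ J) {w : Tractor n}
    (hw : ∀ b < k, tractorForm G (c t) (ConformalCurve.derivedTractor G c b t) w = 0) :
    tractorForm G (c t) (V t) w = 0 := by
  obtain ⟨x, -, hxV⟩ := hV
  rw [hxV t ht]
  simp only [map_sum, map_smul, LinearMap.sum_apply, LinearMap.smul_apply]
  exact Finset.sum_eq_zero fun b hb => by rw [hw b (Finset.mem_range.1 hb), smul_zero]

end InFlag

/-! ### Gram determinants -/

/-- The Gram determinant of the first `j` vectors of a sequence. -/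
def gramDet {E : Type*} [AddCommGroup E] [Module ℝ E] (B : LinearMap.BilinForm ℝ E) (d : ℕ → E)
    (j : ℕ) : ℝ :=
  (Matrix.of fun a b : Fin j => B (d a) (d b)).det

theorem gramDelta_eq_gramDet (j : ℕ) (t : ℝ) : gramDelta G c j t =
    gramDet (tractorForm G (c t)) (fun k => derivedTractor G c k t) j := rfl

/-- The Gram matrix transforms as `A B Aᵀ` with `A` lower triangular, so only the diagonal entries
`a k` are seen by the determinant. -/
theorem gramDet_of_triangular {E : Type*} [AddCommGroup E] [Module ℝ E]
    (B : LinearMap.BilinForm ℝ E) {d d' : ℕ → E} {a : ℕ → ℝ} {x : ℕ → ℕ → ℝ} {j : ℕ}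
    (hd : ∀ k < j, d' k = a k • d k + ∑ b ∈ Finset.range k, x k b • d b) :
    gramDet B d' j = (∏ k ∈ Finset.range j, a k) ^ 2 * gramDet B d j := by
  let A : Matrix (Fin j) (Fin j) ℝ :=
    Matrix.of fun k b => if b < k then x k b else if b = k then a k else 0
  have hA : A.det = ∏ k ∈ Finset.range j, a k := by
    have : A.BlockTriangular OrderDual.toDual := fun i k hik => by
      have hik : i < k := hik
      simp [A, hik.not_gt, hik.ne']
    rw [Matrix.det_of_isLowerTriangular A this, Finset.prod_range]
    simp [A]
  have hd' (k : Fin j) : d' k = ∑ b, A k b • d b := by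
    have hk := k.isLt
    have : ∑ b, A k b • d b = ∑ b ∈ Finset.range j,
        (if b < (k : ℕ) then x k b else if b = k then a k else 0) • d b := by
      rw [Finset.sum_range]
      refine Finset.sum_congr rfl fun b _ => ?_
      simp only [A, Matrix.of_apply, Fin.ext_iff, Fin.val_fin_lt]
    rw [this, hd k hk, ← Finset.sum_subset (Finset.range_mono (Nat.succ_le_of_lt hk)),
      Finset.sum_range_succ, add_comm]
    · congr 1
      · exact Finset.sum_congr rfl fun b hb => by rw [if_pos (Finset.mem_range.1 hb)]
      · simp
    · intro b _ hb
      have hb : ¬ b < (k : ℕ) + 1 := by simpa using hb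
      rw [if_neg (by omega), if_neg (by omega), zero_smul]
  have hM : (Matrix.of fun p q : Fin j => B (d' p) (d' q)) =
      A * (Matrix.of fun p q : Fin j => B (d p) (d q)) * A.transpose := by
    ext p q
    simp only [Matrix.of_apply, Matrix.mul_apply, Matrix.transpose_apply, hd', map_sum, map_smul,
      LinearMap.sum_apply, LinearMap.smul_apply, smul_eq_mul, Finset.sum_mul, Finset.mul_sum]
    exact Finset.sum_congr rfl fun r _ => Finset.sum_congr rfl fun s _ => by ring
  unfold gramDet
  rw [hM, Matrix.det_mul, Matrix.det_mul, Matrix.det_transpose, hA]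
  ring

/-- Replacing the last vector by `v` is a unitriangular change, and afterwards the last row of the
Gram matrix vanishes except for its diagonal entry. -/
theorem gramDet_succ_of_orthogonal {E : Type*} [AddCommGroup E] [Module ℝ E]
    (B : LinearMap.BilinForm ℝ E) {d : ℕ → E} {x : ℕ → ℝ} {m : ℕ} {v : E}
    (hv : v = d m + ∑ b ∈ Finset.range m, x b • d b) (hB : ∀ b < m, B v (d b) = 0) :
    gramDet B d (m + 1) = gramDet B d m * B v v := by
  classical
  have h1 : gramDet B (Function.update d m v) (m + 1) = gramDet B d (m + 1) := by
    have := gramDet_of_triangular B (d := d) (d' := Function.update d m v) (a := fun _ => 1)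
      (x := fun k b => if k = m then x b else 0) (j := m + 1) fun k _ => by
        by_cases hkm : k = m
        · subst hkm
          simp [hv]
        · simp [hkm]
    simpa using this
  rw [← h1]
  unfold gramDet
  rw [Matrix.det_succ_row _ (Fin.last m), Fin.sum_univ_castSucc]
  rw [Finset.sum_eq_zero fun b _ => ?_]
  · simp only [Matrix.of_apply, Fin.val_last, Function.update_self, zero_add, Fin.succAbove_last]
    rw [Even.neg_one_pow (by simp), one_mul, mul_comm]
    congr 2
    ext p q
    simp [p.isLt.ne, q.isLt.ne]
  · have hb := b.isLt
    simp [Function.update_of_ne hb.ne, hB b hb]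

end

section

variable {n : ℕ} {G : EuclideanSpace ℝ (Fin n) → Matrix (Fin n) (Fin n) ℝ}
  {c : ℝ → EuclideanSpace ℝ (Fin n)} {J : Set ℝ}

namespace IsRegularCurve

section Gram

variable (h : IsRegularCurve G c J) {t : ℝ} (ht : t ∈ J)
include h ht

/-! ### The first inner products of derived tractors -/

omit h ht in
theorem tractorInner_derivedTractor_zero (t : ℝ) (V : Tractor n) :
    tractorInner G (c t) (derivedTractor G c 0 t) V = (speed G c t)⁻¹ * V.1 := by
  simp [tractorInner, derivedTractor]

omit h ht in
theorem inner_zero_zero (t : ℝ) :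
    tractorInner G (c t) (derivedTractor G c 0 t) (derivedTractor G c 0 t) = 0 := by
  rw [tractorInner_derivedTractor_zero]
  simp [derivedTractor]

omit h ht in
theorem derivedTractor_one_fst (t : ℝ) : (derivedTractor G c 1 t).1 = 0 := by
  simp [derivedTractor, tractorDeriv]

omit h ht in
theorem inner_zero_one (t : ℝ) :
    tractorInner G (c t) (derivedTractor G c 0 t) (derivedTractor G c 1 t) = 0 := by
  rw [tractorInner_derivedTractor_zero, derivedTractor_one_fst, mul_zero]

theorem inner_one_one :
    tractorInner G (c t) (derivedTractor G c 1 t) (derivedTractor G c 1 t) = 1 := by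
  have h1 (k : Fin n) : (derivedTractor G c 1 t).2.1 k = (speed G c t)⁻¹ * velocity c t k := by
    simp [derivedTractor, tractorDeriv]
  have hu := (h.speed_pos ht).ne'
  have h2 : ∑ i, ∑ j, G (c t) i j * ((speed G c t)⁻¹ * velocity c t i) *
      ((speed G c t)⁻¹ * velocity c t j) = (speed G c t)⁻¹ ^ 2 * speed G c t ^ 2 := by
    rw [← h.speed_sq ht]
    simp only [Finset.mul_sum]
    exact Finset.sum_congr rfl fun i _ => Finset.sum_congr rfl fun j _ => by ring
  unfold tractorInner
  simp only [h1, derivedTractor_one_fst, h2]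
  field_simp
  simp

theorem inner_add_inner_eq_deriv (a b : ℕ) :
    tractorInner G (c t) (derivedTractor G c (a + 1) t) (derivedTractor G c b t)
      + tractorInner G (c t) (derivedTractor G c a t) (derivedTractor G c (b + 1) t) =
    deriv (fun τ => tractorInner G (c τ) (derivedTractor G c a τ) (derivedTractor G c b τ)) t :=
  (hasDerivAt_tractorInner h ht ((h.contDiffAt_derivedTractor ht a).differentiableAt (by simp))
    ((h.contDiffAt_derivedTractor ht b).differentiableAt (by simp))).deriv.symm

/-- The source of the next low products: differentiating one that is constant on `J` gives a linear
relation between products of higher index. -/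
theorem inner_add_inner_eq_zero {a b : ℕ} {r : ℝ} (hr : ∀ τ ∈ J,
      tractorInner G (c τ) (derivedTractor G c a τ) (derivedTractor G c b τ) = r) :
    tractorInner G (c t) (derivedTractor G c (a + 1) t) (derivedTractor G c b t)
      + tractorInner G (c t) (derivedTractor G c a t) (derivedTractor G c (b + 1) t) = 0 := by
  rw [h.inner_add_inner_eq_deriv ht,
    Filter.EventuallyEq.deriv_eq (Filter.eventually_of_mem (h.isOpen.mem_nhds ht) hr)]
  simp

theorem inner_zero_two :
    tractorInner G (c t) (derivedTractor G c 0 t) (derivedTractor G c 2 t) = -1 := by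
  have h1 := h.inner_add_inner_eq_zero ht (a := 0) (b := 1) fun τ _ => inner_zero_one τ
  have h2 := h.inner_one_one ht
  simp only [zero_add, Nat.reduceAdd] at h1
  linarith

theorem inner_one_two :
    tractorInner G (c t) (derivedTractor G c 1 t) (derivedTractor G c 2 t) = 0 := by
  have h1 := h.inner_add_inner_eq_zero ht (a := 1) (b := 1) fun τ hτ => h.inner_one_one hτ
  rw [tractorInner_comm h.symm] at h1
  simp only [Nat.reduceAdd] at h1
  linarith

theorem inner_zero_three :
    tractorInner G (c t) (derivedTractor G c 0 t) (derivedTractor G c 3 t) = 0 := by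
  have h1 := h.inner_add_inner_eq_zero ht (a := 0) (b := 2) fun τ hτ => h.inner_zero_two hτ
  have h2 := h.inner_one_two ht
  simp only [zero_add, Nat.reduceAdd] at h1
  linarith

theorem inner_one_three :
    tractorInner G (c t) (derivedTractor G c 1 t) (derivedTractor G c 3 t) =
      -tractorInner G (c t) (derivedTractor G c 2 t) (derivedTractor G c 2 t) := by
  have h1 := h.inner_add_inner_eq_zero ht (a := 1) (b := 2) fun τ hτ => h.inner_one_two hτ
  simp only [Nat.reduceAdd] at h1
  linarith

/-! ### Positivity -/

omit h ht in
theorem _root_.ConformalCurve.tractorInner_self_of_fst_eq_zero (y : EuclideanSpace ℝ (Fin n))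
    {V : Tractor n} (hV : V.1 = 0) :
    tractorInner G y V V = ∑ i, ∑ j, G y i j * V.2.1 i * V.2.1 j := by
  simp [tractorInner, hV]

theorem fst_eq_zero {V : Tractor n}
    (hV : tractorInner G (c t) (derivedTractor G c 0 t) V = 0) : V.1 = 0 := by
  rw [tractorInner_derivedTractor_zero] at hV
  exact (mul_eq_zero.1 hV).resolve_left (inv_ne_zero (h.speed_pos ht).ne')

/-- Since `T` lives in the last slot, orthogonality to it kills the first slot of `V`, and the
tractor metric reduces to `g` on the middle slot. -/
theorem inner_self_nonneg {V : Tractor n}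
    (hV : tractorInner G (c t) (derivedTractor G c 0 t) V = 0) :
    0 ≤ tractorInner G (c t) V V := by
  rw [tractorInner_self_of_fst_eq_zero _ (h.fst_eq_zero ht hV)]
  by_cases h0 : V.2.1 = 0
  · simp [h0]
  · exact (sum_pos_of_posDef (h.posDef t ht) h0).le

/-- The null vectors of the semidefinite form on the orthogonal complement of `T` are the multiples
of `T`; these are excluded by `U'`, because `⟨T, U'⟩ = -1`. -/
theorem eq_zero_of_inner_self {V : Tractor n}
    (hV0 : tractorInner G (c t) (derivedTractor G c 0 t) V = 0)
    (hV2 : tractorInner G (c t) (derivedTractor G c 2 t) V = 0)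
    (hV : tractorInner G (c t) V V = 0) : V = 0 := by
  have h1 := h.fst_eq_zero ht hV0
  have h2 : V.2.1 = 0 := by
    by_contra h0
    rw [tractorInner_self_of_fst_eq_zero _ h1] at hV
    exact (sum_pos_of_posDef (h.posDef t ht) h0).ne' hV
  have h3 : (derivedTractor G c 2 t).1 ≠ 0 := fun h0 => by
    have := h.inner_zero_two ht
    rw [tractorInner_derivedTractor_zero, h0] at this
    norm_num at this
  have h4 : V.2.2 = 0 := by
    simp only [tractorInner, h1, h2] at hV2
    simpa [h3] using hV2
  ext k
  · exact h1
  · exact congrFun h2 k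
  · exact h4

/-- A kernel vector of the Gram matrix gives a combination of the `D_k` orthogonal to all of them,
itself included. The bound `3 ≤ j` puts `T` and `U'` among them; for `j = 1, 2` the determinant is
zero. -/
theorem gramDelta_ne_zero {N j : ℕ} (hj : 3 ≤ j) (hjN : j ≤ N)
    (hli : LinearIndependent ℝ (fun k : Fin N => derivedTractor G c k t)) :
    gramDelta G c j t ≠ 0 := by
  intro h0
  obtain ⟨x, hx0, hx⟩ := Matrix.exists_mulVec_eq_zero_iff.2 h0
  let V : Tractor n := ∑ b, x b • derivedTractor G c b t
  have hV (a : ℕ) (ha : a < j) : tractorForm G (c t) (derivedTractor G c a t) V = 0 := by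
    have := congrFun hx ⟨a, ha⟩
    simp only [Matrix.mulVec, dotProduct, Matrix.of_apply, Pi.zero_apply, tractorInner_eq] at this
    simp only [V, map_sum, map_smul, smul_eq_mul]
    rw [← this]
    exact Finset.sum_congr rfl fun b _ => mul_comm _ _
  have hVV : tractorForm G (c t) V V = 0 := by
    nth_rewrite 1 [show V = ∑ b, x b • derivedTractor G c b t from rfl]
    simp only [map_sum, map_smul, LinearMap.sum_apply, LinearMap.smul_apply]
    exact Finset.sum_eq_zero fun b _ => by rw [hV b b.isLt, smul_zero]
  have hV0 : V = 0 :=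
    h.eq_zero_of_inner_self ht (hV 0 (by omega)) (hV 2 (by omega)) hVV
  have hli' : LinearIndependent ℝ (fun k : Fin j => derivedTractor G c k t) :=
    hli.comp (Fin.castLE hjN) (Fin.castLE_injective hjN)
  exact hx0 (funext (Fintype.linearIndependent_iff.1 hli' x hV0))

theorem gramDelta_three : gramDelta G c 3 t = -1 := by
  have h02 := h.inner_zero_two ht
  have h12 := h.inner_one_two ht
  have h20 := h02
  have h21 := h12
  have h10 := inner_zero_one (G := G) (c := c) t
  rw [tractorInner_comm h.symm] at h20 h21 h10
  simp only [gramDelta, Matrix.det_fin_three, Matrix.of_apply, Fin.val_zero, Fin.val_one,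
    Fin.val_two, h02, h12, h20, h21, h10, inner_zero_zero, inner_zero_one, h.inner_one_one ht]
  ring

theorem gramDelta_four : gramDelta G c 4 t = -arcDensity G c t := by
  have h02 := h.inner_zero_two ht
  have h12 := h.inner_one_two ht
  have h03 := h.inner_zero_three ht
  have h13 := h.inner_one_three ht
  have h20 := h02
  have h21 := h12
  have h30 := h03
  have h31 := h13
  have h10 := inner_zero_one (G := G) (c := c) t
  rw [tractorInner_comm h.symm] at h20 h21 h10 h30 h31
  simp [gramDelta, arcDensity, Matrix.det_succ_row_zero, Fin.sum_univ_succ, Fin.succAbove,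
    h02, h12, h20, h21, h10, h03, h30, h13, h31,
    inner_zero_zero, inner_zero_one, h.inner_one_one ht]
  ring

end Gram

end IsRegularCurve

/-! ### The Frenet frame -/

/-- The part of the derived tractor with index `m + 3` that is orthogonal to the preceding
members of the Frenet frame. -/
def frenetVec (G : EuclideanSpace ℝ (Fin n) → Matrix (Fin n) (Fin n) ℝ)
    (c : ℝ → EuclideanSpace ℝ (Fin n)) (m : ℕ) (t : ℝ) : Tractor n :=
  derivedTractor G c (m + 3) t
    - ∑ j : Fin m, tractorForm G (c t) (derivedTractor G c (m + 3) t)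
        (frenetFrame G c (j + 3) t) • frenetFrame G c (j + 3) t
    - tractorForm G (c t) (derivedTractor G c (m + 3) t) (frenetFrame G c 0 t)
        • frenetFrame G c 2 t
    - tractorForm G (c t) (derivedTractor G c (m + 3) t) (frenetFrame G c 1 t)
        • frenetFrame G c 1 t
    - tractorForm G (c t) (derivedTractor G c (m + 3) t) (frenetFrame G c 2 t)
        • frenetFrame G c 0 t

theorem frenetFrame_zero (t : ℝ) : frenetFrame G c 0 t = derivedTractor G c 0 t := by
  rw [frenetFrame]

theorem frenetFrame_one (t : ℝ) : frenetFrame G c 1 t = derivedTractor G c 1 t := by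
  rw [frenetFrame]

theorem frenetFrame_two (t : ℝ) : frenetFrame G c 2 t = -derivedTractor G c 2 t
    - ((1 / 2 : ℝ) * tractorForm G (c t) (derivedTractor G c 2 t) (derivedTractor G c 2 t))
        • derivedTractor G c 0 t := by
  rw [frenetFrame]
  rfl

theorem frenetFrame_add_three (m : ℕ) (t : ℝ) : frenetFrame G c (m + 3) t =
    (Real.sqrt (tractorForm G (c t) (frenetVec G c m t) (frenetVec G c m t)))⁻¹
      • frenetVec G c m t := by
  rw [frenetFrame]
  rfl

end

/-! ### Orthogonality of the Frenet frame and its curvatures -/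

section

variable {n : ℕ} {G : EuclideanSpace ℝ (Fin n) → Matrix (Fin n) (Fin n) ℝ}
  {c : ℝ → EuclideanSpace ℝ (Fin n)} {J : Set ℝ}

/-- The properties of the member with index `m + 3` of the Frenet frame that are proved by
induction on `m`. -/
structure IsFrenetStep (G : EuclideanSpace ℝ (Fin n) → Matrix (Fin n) (Fin n) ℝ)
    (c : ℝ → EuclideanSpace ℝ (Fin n)) (J : Set ℝ) (m : ℕ) : Prop where
  inFlag : InFlag G c J (m + 3) (fun t => frenetVec G c m t - derivedTractor G c (m + 3) t)
  orthogonal_frame : ∀ t ∈ J, ∀ k < m + 3,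
    tractorForm G (c t) (frenetVec G c m t) (frenetFrame G c k t) = 0
  orthogonal_derived : ∀ t ∈ J, ∀ k < m + 3,
    tractorForm G (c t) (frenetVec G c m t) (derivedTractor G c k t) = 0
  gramDelta_eq : ∀ t ∈ J, gramDelta G c (m + 4) t =
    gramDelta G c (m + 3) t * tractorForm G (c t) (frenetVec G c m t) (frenetVec G c m t)
  norm_pos : ∀ t ∈ J, 0 < tractorForm G (c t) (frenetVec G c m t) (frenetVec G c m t)

namespace IsFrenetStep

variable {m : ℕ}

theorem frenetFrame_self (hm : IsFrenetStep G c J m) {t : ℝ} (ht : t ∈ J) :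
    tractorForm G (c t) (frenetFrame G c (m + 3) t) (frenetFrame G c (m + 3) t) = 1 := by
  have h0 := hm.norm_pos t ht
  rw [frenetFrame_add_three]
  simp only [map_smul, LinearMap.smul_apply, smul_eq_mul]
  have h1 := (Real.sqrt_pos.2 h0).ne'
  have h2 := Real.mul_self_sqrt h0.le
  nth_rewrite 3 [← h2]
  field_simp

theorem frenetFrame_lt (hm : IsFrenetStep G c J m) {t : ℝ} (ht : t ∈ J) {k : ℕ}
    (hk : k < m + 3) :
    tractorForm G (c t) (frenetFrame G c (m + 3) t) (frenetFrame G c k t) = 0 := by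
  rw [frenetFrame_add_three]
  simp [hm.orthogonal_frame t ht k hk]

theorem contDiffAt_inv_norm (h : IsRegularCurve G c J) (hm : IsFrenetStep G c J m) {t : ℝ}
    (ht : t ∈ J) : ContDiffAt ℝ ∞ (fun τ =>
      (Real.sqrt (tractorForm G (c τ) (frenetVec G c m τ) (frenetVec G c m τ)))⁻¹) t := by
  have hpos := hm.norm_pos t ht
  have hV : ContDiffAt ℝ ∞ (frenetVec G c m) t := by
    have := (hm.inFlag.contDiffAt h ht).add (h.contDiffAt_derivedTractor ht (m + 3))
    simpa using this
  exact ((h.contDiffAt_tractorInner ht hV hV).sqrt hpos.ne').inv (Real.sqrt_pos.2 hpos).ne'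

theorem inFlag_frenetFrame (h : IsRegularCurve G c J) (hm : IsFrenetStep G c J m) :
    InFlag G c J (m + 4) (frenetFrame G c (m + 3)) := by
  refine (((hm.inFlag.mono (Nat.le_succ _)).add (InFlag.derivedTractor (Nat.lt_succ_self _))).smul
    fun t ht => hm.contDiffAt_inv_norm h ht).congr fun t ht => ?_
  rw [frenetFrame_add_three, sub_add_cancel]

end IsFrenetStep

namespace IsRegularCurve

variable (h : IsRegularCurve G c J)
include h

theorem frame_zero_two {t : ℝ} (ht : t ∈ J) :
    tractorForm G (c t) (frenetFrame G c 0 t) (frenetFrame G c 2 t) = 1 := by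
  have h1 := h.inner_zero_two ht
  have h0 := inner_zero_zero (G := G) (c := c) t
  rw [tractorInner_eq] at h1 h0
  rw [frenetFrame_zero, frenetFrame_two]
  simp [h1, h0]

theorem frame_one_two {t : ℝ} (ht : t ∈ J) :
    tractorForm G (c t) (frenetFrame G c 1 t) (frenetFrame G c 2 t) = 0 := by
  have h1 := h.inner_one_two ht
  have h0 := inner_zero_one (G := G) (c := c) t
  rw [tractorInner_eq] at h1 h0
  rw [tractorForm_comm h.symm] at h0
  rw [frenetFrame_one, frenetFrame_two]
  simp [h1, h0]

theorem frame_two_two {t : ℝ} (ht : t ∈ J) :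
    tractorForm G (c t) (frenetFrame G c 2 t) (frenetFrame G c 2 t) = 0 := by
  have h1 := h.inner_zero_two ht
  have h0 := inner_zero_zero (G := G) (c := c) t
  rw [tractorInner_eq] at h1 h0
  have h2 := h1
  rw [tractorForm_comm h.symm] at h2
  rw [frenetFrame_two]
  simp [h1, h0, h2]
  ring

theorem inFlag_frenetFrame_two : InFlag G c J 3 (frenetFrame G c 2) := by
  refine ((InFlag.derivedTractor (by omega : 2 < 3)).neg.sub
    ((InFlag.derivedTractor (by omega : 0 < 3)).smul (r := fun t => (1 / 2 : ℝ) *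
      tractorForm G (c t) (derivedTractor G c 2 t) (derivedTractor G c 2 t)) fun t ht => ?_)).congr
    fun t _ => frenetFrame_two t
  have hD := h.contDiffAt_derivedTractor ht 2
  exact contDiffAt_const.mul (h.contDiffAt_tractorInner ht hD hD)

theorem inFlag_frenetFrame {m : ℕ} (ih : ∀ j < m, IsFrenetStep G c J j) {k : ℕ}
    (hk : k < m + 3) : InFlag G c J (k + 1) (frenetFrame G c k) := by
  match k, hk with
  | 0, _ => exact (InFlag.derivedTractor (by omega)).congr fun t _ => frenetFrame_zero t
  | 1, _ => exact (InFlag.derivedTractor (by omega)).congr fun t _ => frenetFrame_one t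
  | 2, _ => exact h.inFlag_frenetFrame_two
  | j + 3, hk => exact (ih j (by omega)).inFlag_frenetFrame h

theorem frenetFrame_orthonormal {m : ℕ} (ih : ∀ j < m, IsFrenetStep G c J j) {t : ℝ} (ht : t ∈ J)
    {j k : ℕ} (hj : j < m) (hk : k < m) :
    tractorForm G (c t) (frenetFrame G c (j + 3) t) (frenetFrame G c (k + 3) t) =
      if j = k then 1 else 0 := by
  rcases lt_trichotomy j k with hjk | rfl | hjk
  · rw [if_neg hjk.ne, tractorForm_comm h.symm]
    exact (ih k hk).frenetFrame_lt ht (by omega)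
  · rw [if_pos rfl, (ih j hj).frenetFrame_self ht]
  · rw [if_neg hjk.ne', (ih j hj).frenetFrame_lt ht (by omega)]

/-- `U_0` and `U_2` form a null pair with product `1` and the other members are orthonormal. So the
coefficient of `U_2` in a projection is the product with `U_0` and conversely, which is the crossing
of indices in `frenetVec`. -/
theorem frenetVec_orthogonal_frame {m : ℕ} (ih : ∀ j < m, IsFrenetStep G c J j) {t : ℝ}
    (ht : t ∈ J) {k : ℕ} (hk : k < m + 3) :
    tractorForm G (c t) (frenetVec G c m t) (frenetFrame G c k t) = 0 := by
  have h00 : tractorForm G (c t) (frenetFrame G c 0 t) (frenetFrame G c 0 t) = 0 := by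
    rw [frenetFrame_zero]; exact inner_zero_zero t
  have h01 : tractorForm G (c t) (frenetFrame G c 0 t) (frenetFrame G c 1 t) = 0 := by
    rw [frenetFrame_zero, frenetFrame_one]; exact inner_zero_one t
  have h11 : tractorForm G (c t) (frenetFrame G c 1 t) (frenetFrame G c 1 t) = 1 := by
    rw [frenetFrame_one]; exact h.inner_one_one ht
  have h02 := h.frame_zero_two ht
  have h12 := h.frame_one_two ht
  have h22 := h.frame_two_two ht
  have h10 := tractorForm_comm h.symm (c t) (frenetFrame G c 1 t) (frenetFrame G c 0 t)
  have h20 := tractorForm_comm h.symm (c t) (frenetFrame G c 2 t) (frenetFrame G c 0 t)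
  have h21 := tractorForm_comm h.symm (c t) (frenetFrame G c 2 t) (frenetFrame G c 1 t)
  have hlow (l : ℕ) (hl : l < 3) (j : Fin m) :
      tractorForm G (c t) (frenetFrame G c (j + 3) t) (frenetFrame G c l t) = 0 :=
    (ih j j.isLt).frenetFrame_lt ht (by omega)
  simp only [frenetVec, map_sub, map_sum, map_smul, LinearMap.sub_apply, LinearMap.sum_apply,
    LinearMap.smul_apply, smul_eq_mul]
  match k, hk with
  | 0, _ => simp [hlow 0, h00, h10, h20, h01, h02]
  | 1, _ => simp [hlow 1, h11, h21, h01, h12]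
  | 2, _ => simp [hlow 2, h22, h02, h12]
  | l + 3, hk =>
    have hl : l < m := by omega
    have hup (a : ℕ) (ha : a < 3) :
        tractorForm G (c t) (frenetFrame G c a t) (frenetFrame G c (l + 3) t) = 0 := by
      rw [tractorForm_comm h.symm]
      exact (ih l hl).frenetFrame_lt ht (by omega)
    rw [hup 0 (by omega), hup 1 (by omega), hup 2 (by omega),
      Finset.sum_eq_single (⟨l, hl⟩ : Fin m)]
    · simp [h.frenetFrame_orthonormal ih ht hl hl]
    · intro j _ hj
      rw [h.frenetFrame_orthonormal ih ht j.isLt hl, if_neg fun e => hj (Fin.ext e), mul_zero]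
    · simp

omit h in
-- Each frame member is a nonzero multiple of a derived tractor plus other terms orthogonal to `W`,
-- so the defining formula can be solved for the derived tractor.
theorem orthogonal_derived_of_orthogonal_frame {m : ℕ} (ih : ∀ j < m, IsFrenetStep G c J j)
    {t : ℝ} (ht : t ∈ J) {W : Tractor n}
    (hW : ∀ k < m + 3, tractorForm G (c t) W (frenetFrame G c k t) = 0) {k : ℕ}
    (hk : k < m + 3) : tractorForm G (c t) W (derivedTractor G c k t) = 0 := by
  have h0 : tractorForm G (c t) W (derivedTractor G c 0 t) = 0 := by
    rw [← frenetFrame_zero]; exact hW 0 (by omega)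
  match k, hk with
  | 0, _ => exact h0
  | 1, _ => rw [← frenetFrame_one]; exact hW 1 (by omega)
  | 2, _ =>
    have := hW 2 (by omega)
    rw [frenetFrame_two] at this
    simpa [h0] using this
  | j + 3, hk =>
    have hj := (ih j (by omega)).norm_pos t ht
    have h1 := hW (j + 3) hk
    rw [frenetFrame_add_three, map_smul, smul_eq_mul] at h1
    have h2 := (mul_eq_zero.1 h1).resolve_left (inv_ne_zero (Real.sqrt_pos.2 hj).ne')
    simp only [frenetVec, map_sub, map_sum, map_smul, smul_eq_mul] at h2
    rw [Finset.sum_eq_zero fun l _ => by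
      rw [hW _ (by have := l.isLt; omega), mul_zero]] at h2
    simpa [hW 0, hW 1, hW 2] using h2

/-- Strong induction is needed because the positive norms of the earlier vectors make the earlier
frame members normalized and smooth, on which orthogonality and flag membership of the next vector
rest. -/
theorem isFrenetStep {N : ℕ} (hΔ : ∀ t ∈ J, ∀ j, 3 ≤ j → j ≤ N → gramDelta G c j t ≠ 0) (m : ℕ)
    (hm : m + 4 ≤ N) : IsFrenetStep G c J m := by
  induction m using Nat.strong_induction_on with
  | _ m ih =>
  have ih : ∀ j < m, IsFrenetStep G c J j := fun j hj => ih j hj (by omega)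
  have hframe : ∀ t ∈ J, ∀ k < m + 3,
      tractorForm G (c t) (frenetVec G c m t) (frenetFrame G c k t) = 0 :=
    fun t ht k hk => h.frenetVec_orthogonal_frame ih ht hk
  have hder : ∀ t ∈ J, ∀ k < m + 3,
      tractorForm G (c t) (frenetVec G c m t) (derivedTractor G c k t) = 0 :=
    fun t ht k hk => orthogonal_derived_of_orthogonal_frame ih ht (hframe t ht) hk
  have hflag : InFlag G c J (m + 3)
      (fun t => frenetVec G c m t - derivedTractor G c (m + 3) t) := by
    have hterm (k l : ℕ) (hk : k < m + 3) (hl : l < m + 3) : InFlag G c J (m + 3) (fun t =>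
        tractorForm G (c t) (derivedTractor G c (m + 3) t) (frenetFrame G c k t)
          • frenetFrame G c l t) :=
      ((h.inFlag_frenetFrame ih hl).mono hl).smul fun t ht =>
        h.contDiffAt_tractorInner ht (h.contDiffAt_derivedTractor ht _)
          ((h.inFlag_frenetFrame ih hk).contDiffAt h ht)
    have hsum : InFlag G c J (m + 3) (fun t => ∑ j : Fin m,
        tractorForm G (c t) (derivedTractor G c (m + 3) t) (frenetFrame G c (j + 3) t)
          • frenetFrame G c (j + 3) t) :=
      InFlag.sum _ fun j _ => hterm _ _ (by have := j.isLt; omega) (by have := j.isLt; omega)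
    refine (((hsum.neg.sub (hterm 0 2 (by omega) (by omega))).sub
      (hterm 1 1 (by omega) (by omega))).sub (hterm 2 0 (by omega) (by omega))).congr
      fun t _ => ?_
    unfold frenetVec
    abel
  have hgram : ∀ t ∈ J, gramDelta G c (m + 4) t = gramDelta G c (m + 3) t *
      tractorForm G (c t) (frenetVec G c m t) (frenetVec G c m t) := by
    intro t ht
    obtain ⟨x, -, hx⟩ := hflag
    exact gramDet_succ_of_orthogonal _ (x := fun b => x b t)
      (eq_add_of_sub_eq' (hx t ht)) (hder t ht)
  refine ⟨hflag, hframe, hder, hgram, fun t ht => ?_⟩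
  -- Orthogonality to `T` gives a nonnegative norm; if it vanished, the recursion would force
  -- `Δ_{m+4} = 0`.
  refine lt_of_le_of_ne (h.inner_self_nonneg ht ?_) fun h0 => ?_
  · rw [tractorInner_comm h.symm]
    exact hder t ht 0 (by omega)
  · refine hΔ t ht (m + 4) (by omega) hm ?_
    rw [hgram t ht, ← h0, mul_zero]

theorem gramDelta_neg {N : ℕ} (hΔ : ∀ t ∈ J, ∀ j, 3 ≤ j → j ≤ N → gramDelta G c j t ≠ 0)
    {t : ℝ} (ht : t ∈ J) (m : ℕ) (hm : m + 3 ≤ N) : gramDelta G c (m + 3) t < 0 := by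
  induction m with
  | zero => rw [h.gramDelta_three ht]; norm_num
  | succ m ih =>
    have hs := h.isFrenetStep hΔ m hm
    rw [hs.gramDelta_eq t ht]
    exact mul_neg_of_neg_of_pos (ih (by omega)) (hs.norm_pos t ht)

/-- The higher curvature of the Frenet frame in terms of Gram determinants, for the
parametrization of the frame. -/
theorem higherCurvature_eq {N : ℕ}
    (hΔ : ∀ t ∈ J, ∀ j, 3 ≤ j → j ≤ N → gramDelta G c j t ≠ 0) {t : ℝ} (ht : t ∈ J) (m : ℕ)
    (hm : m + 5 ≤ N) : higherCurvature G c (m + 2) t =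
      Real.sqrt (gramDelta G c (m + 3) t * gramDelta G c (m + 5) t)
        / (-gramDelta G c (m + 4) t) := by
  have h1 := h.isFrenetStep hΔ m (by omega)
  have h2 := h.isFrenetStep hΔ (m + 1) (by omega)
  set r := fun τ => (Real.sqrt (tractorForm G (c τ) (frenetVec G c m τ) (frenetVec G c m τ)))⁻¹
    with hr
  have hrs : ∀ τ ∈ J, ContDiffAt ℝ ∞ r τ := fun τ hτ => h1.contDiffAt_inv_norm h hτ
  have hF := h1.inFlag.smul hrs
  -- The frame member is split into its leading term `r D_{m+3}` and a remainder in the flag of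
  -- level `m + 3`. After differentiation only `r D_{m+4}` lies outside the span of `D_0, …,
  -- D_{m+3}`, to which the next Frenet vector is orthogonal.
  have hD : tractorDeriv G c (frenetFrame G c (m + 3)) t =
      deriv r t • derivedTractor G c (m + 3) t + r t • derivedTractor G c (m + 4) t
      + tractorDeriv G c (fun τ => r τ • (frenetVec G c m τ - derivedTractor G c (m + 3) τ)) t := by
    have hd := (h.contDiffAt_derivedTractor ht (m + 3)).differentiableAt (by simp)
    have hrd := (hrs t ht).differentiableAt (by simp)
    have e : frenetFrame G c (m + 3) = fun τ => r τ • derivedTractor G c (m + 3) τ +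
        r τ • (frenetVec G c m τ - derivedTractor G c (m + 3) τ) := by
      funext τ
      rw [frenetFrame_add_three, ← smul_add, add_sub_cancel]
    rw [e, tractorDeriv_add (hrd.fun_smul hd) ((hF.contDiffAt h ht).differentiableAt (by simp)),
      tractorDeriv_smul hrd hd]
    rfl
  have horth : ∀ b < m + 4, tractorForm G (c t) (derivedTractor G c b t)
      (frenetVec G c (m + 1) t) = 0 := fun b hb => by
    rw [tractorForm_comm h.symm]
    exact h2.orthogonal_derived t ht b hb
  have hlast : tractorForm G (c t) (derivedTractor G c (m + 4) t) (frenetVec G c (m + 1) t) =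
      tractorForm G (c t) (frenetVec G c (m + 1) t) (frenetVec G c (m + 1) t) := by
    have := h2.inFlag.tractorForm_eq_zero ht horth
    rw [map_sub, LinearMap.sub_apply, sub_eq_zero] at this
    exact this.symm
  have hK : higherCurvature G c (m + 2) t =
      tractorForm G (c t) (tractorDeriv G c (frenetFrame G c (m + 3)) t)
        (frenetFrame G c (m + 1 + 3) t) := rfl
  have hN1 := h1.norm_pos t ht
  have hN2 := h2.norm_pos t ht
  have hg1 := h1.gramDelta_eq t ht
  have hg2 := h2.gramDelta_eq t ht
  have hneg := h.gramDelta_neg hΔ ht m (by omega)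
  rw [hK, hD, frenetFrame_add_three]
  simp only [map_add, map_smul, LinearMap.add_apply, LinearMap.smul_apply, smul_eq_mul]
  rw [(hF.tractorDeriv h).tractorForm_eq_zero ht horth, horth _ (by omega), hlast]
  simp only [hr]
  change gramDelta G c (m + 5) t = gramDelta G c (m + 4) t * _ at hg2
  rw [hg2, hg1]
  generalize tractorForm G (c t) (frenetVec G c m t) (frenetVec G c m t) = x at *
  generalize tractorForm G (c t) (frenetVec G c (m + 1) t) (frenetVec G c (m + 1) t) = y at *
  generalize gramDelta G c (m + 3) t = d at *
  -- Here `d = Δ_{m+3}`, and `x`, `y` are the squared norms of the two Frenet vectors. As `d < 0`,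
  -- the root of `d²` is `-d`, and both sides reduce to `√y / √x`.
  have e : d * (d * x * y) = (-d) ^ 2 * (x * y) := by ring
  rw [e, Real.sqrt_mul (sq_nonneg _), Real.sqrt_sq (by linarith), Real.sqrt_mul hN1.le]
  have hx := Real.mul_self_sqrt hN1.le
  have hy := Real.mul_self_sqrt hN2.le
  have hsx := Real.sqrt_pos.2 hN1
  have hsy := Real.sqrt_pos.2 hN2
  generalize Real.sqrt x = p at *
  generalize Real.sqrt y = q at *
  subst hx hy
  have hd := hneg.ne
  field_simp
  ring

end IsRegularCurve

end

section

variable {n : ℕ} {G : EuclideanSpace ℝ (Fin n) → Matrix (Fin n) (Fin n) ℝ}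
  {c e : ℝ → EuclideanSpace ℝ (Fin n)} {J K : Set ℝ} {s f : ℝ → ℝ}

/-! ### Reparametrization -/

theorem velocity_comp {t r : ℝ} (he : DifferentiableAt ℝ e (s t)) (hs : HasDerivAt s r t)
    (hc : c =ᶠ[nhds t] fun τ => e (s τ)) (k : Fin n) :
    velocity c t k = r * velocity e (s t) k := by
  have h1 : (fun τ => c τ k) =ᶠ[nhds t] fun τ => e (s τ) k := hc.mono fun τ h => by simp [h]
  have h2 := (hasDerivAt_component he k).comp t hs
  rw [velocity, h1.deriv_eq, mul_comm]
  exact h2.deriv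

/-- The chain rule; the algebraic terms of the connection are linear in the velocity and scale by
the same factor `r`. -/
theorem tractorDeriv_comp {t r : ℝ} {V : ℝ → Tractor n} (he : DifferentiableAt ℝ e (s t))
    (hV : DifferentiableAt ℝ V (s t)) (hs : HasDerivAt s r t)
    (hc : c =ᶠ[nhds t] fun τ => e (s τ)) :
    tractorDeriv G c (fun τ => V (s τ)) t = r • tractorDeriv G e V (s t) := by
  have h1 : deriv (fun τ => (V (s τ)).1) t = deriv (fun τ => (V τ).1) (s t) * r :=
    (hV.fst.hasDerivAt.comp t hs).deriv
  have h2 (k : Fin n) : deriv (fun τ => (V (s τ)).2.1 k) t =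
      deriv (fun τ => (V τ).2.1 k) (s t) * r :=
    ((differentiableAt_pi.1 hV.snd.fst k).hasDerivAt.comp t hs).deriv
  have h3 : deriv (fun τ => (V (s τ)).2.2) t = deriv (fun τ => (V τ).2.2) (s t) * r :=
    (hV.snd.snd.hasDerivAt.comp t hs).deriv
  have hv := velocity_comp he hs hc
  have hsum (A : Fin n → Fin n → ℝ) (μ : Fin n → ℝ) :
      ∑ i, ∑ j, A i j * (r * velocity e (s t) i) * μ j =
        r * ∑ i, ∑ j, A i j * velocity e (s t) i * μ j := by
    simp only [Finset.mul_sum]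
    exact Finset.sum_congr rfl fun i _ => Finset.sum_congr rfl fun j _ => by ring
  have hsum' (A : Fin n → Fin n → ℝ) :
      ∑ i, ∑ j, A i j * (r * velocity e (s t) i) = r * ∑ i, ∑ j, A i j * velocity e (s t) i := by
    simpa using hsum A 1
  ext k
  · have := hsum (fun i j => G (e (s t)) i j) (V (s t)).2.1
    simp only [tractorDeriv, h1, hc.self_of_nhds, hv, this, Prod.smul_fst, smul_eq_mul]
    ring
  · simp only [tractorDeriv, h2, hc.self_of_nhds, hv, hsum, hsum', Prod.smul_fst, Prod.smul_snd,
      Pi.smul_apply, smul_eq_mul]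
    ring
  · simp only [tractorDeriv, h3, hc.self_of_nhds, hv, hsum, Prod.smul_snd, smul_eq_mul]
    ring

/-- The curve `c` on `J` is the reparametrization `e ∘ s` of the curve `e` on `K`, and `f` is the
derivative of `s`. -/
structure IsReparametrization (c e : ℝ → EuclideanSpace ℝ (Fin n)) (J K : Set ℝ)
    (s f : ℝ → ℝ) : Prop where
  mapsTo : ∀ t ∈ J, s t ∈ K
  eq : ∀ t ∈ J, c t = e (s t)
  hasDerivAt : ∀ t ∈ J, HasDerivAt s (f t) t
  smooth : ∀ t ∈ J, ContDiffAt ℝ ∞ f t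
  pos : ∀ t ∈ J, 0 < f t

namespace IsReparametrization

variable (hr : IsReparametrization c e J K s f) (h : IsRegularCurve G c J)
  (h' : IsRegularCurve G e K)
include hr h h'

theorem speed_eq {t : ℝ} (ht : t ∈ J) : speed G c t = f t * speed G e (s t) := by
  have hc : c =ᶠ[nhds t] fun τ => e (s τ) :=
    Filter.eventually_of_mem (h.isOpen.mem_nhds ht) hr.eq
  have hv := velocity_comp ((h'.smooth _ (hr.mapsTo t ht)).differentiableAt (by simp))
    (hr.hasDerivAt t ht) hc
  have : ∑ i, ∑ j, G (c t) i j * velocity c t i * velocity c t j =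
      f t ^ 2 * ∑ i, ∑ j, G (e (s t)) i j * velocity e (s t) i * velocity e (s t) j := by
    simp only [hv, hr.eq t ht, Finset.mul_sum]
    exact Finset.sum_congr rfl fun i _ => Finset.sum_congr rfl fun j _ => by ring
  rw [speed, this, Real.sqrt_mul (sq_nonneg _), Real.sqrt_sq (hr.pos t ht).le, speed]

/-- The factor is `f^(1-k)`, written without an exponent that could be negative. It starts with `f`
because the speeds satisfy `u_c = f u_e`, and each derivative in the new parameter contributes
`f⁻¹`. -/
theorem inFlag (k : ℕ) : InFlag G c J k (fun t => derivedTractor G e k (s t)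
    - (f t * (f t)⁻¹ ^ k) • derivedTractor G c k t) := by
  have hfinv : ∀ t ∈ J, ContDiffAt ℝ ∞ (fun τ => (f τ)⁻¹) t := fun t ht =>
    (hr.smooth t ht).inv (hr.pos t ht).ne'
  induction k with
  | zero =>
    refine (InFlag.zero 0).congr fun t ht => ?_
    have hf := (hr.pos t ht).ne'
    simp only [derivedTractor, hr.speed_eq h h' ht]
    ext <;> simp
    field_simp
    simp
  | succ k ih =>
    set a : ℝ → ℝ := fun t => f t * (f t)⁻¹ ^ k with ha
    have has : ∀ t ∈ J, ContDiffAt ℝ ∞ a t := fun t ht =>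
      (hr.smooth t ht).mul ((hfinv t ht).pow k)
    have hlow : InFlag G c J (k + 1) (fun t => deriv a t • derivedTractor G c k t) :=
      (InFlag.derivedTractor (Nat.lt_succ_self k)).smul fun t ht => contDiffAt_deriv (has t ht)
    refine ((hlow.add (ih.tractorDeriv h)).smul hfinv).congr fun t ht => ?_
    have hf := (hr.pos t ht).ne'
    have hD := (h.contDiffAt_derivedTractor ht k).differentiableAt (by simp)
    have had := (has t ht).differentiableAt (by simp)
    have e1 : tractorDeriv G c (fun τ => derivedTractor G e k (s τ)) t =
        f t • derivedTractor G e (k + 1) (s t) :=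
      tractorDeriv_comp ((h'.smooth _ (hr.mapsTo t ht)).differentiableAt (by simp))
        ((h'.contDiffAt_derivedTractor (hr.mapsTo t ht) k).differentiableAt (by simp))
        (hr.hasDerivAt t ht) (Filter.eventually_of_mem (h.isOpen.mem_nhds ht) hr.eq)
    have e2 : (fun τ => derivedTractor G e k (s τ)) = fun τ => a τ • derivedTractor G c k τ
        + (derivedTractor G e k (s τ) - a τ • derivedTractor G c k τ) := by
      funext τ; abel
    rw [e2, tractorDeriv_add (had.fun_smul hD) ((ih.contDiffAt h ht).differentiableAt (by simp)),
      tractorDeriv_smul had hD] at e1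
    have e3 : derivedTractor G e (k + 1) (s t) =
        (f t)⁻¹ • (f t • derivedTractor G e (k + 1) (s t)) := by
      rw [smul_smul, inv_mul_cancel₀ hf, one_smul]
    have e4 : f t * (f t)⁻¹ ^ (k + 1) = (f t)⁻¹ * a t := by
      rw [ha, pow_succ]; ring
    rw [e3, ← e1, e4]
    change _ - _ • tractorDeriv G c (derivedTractor G c k) t = _
    module

theorem gramDelta_eq {t : ℝ} (ht : t ∈ J) (j : ℕ) : gramDelta G e j (s t) =
    (∏ k ∈ Finset.range j, f t * (f t)⁻¹ ^ k) ^ 2 * gramDelta G c j t := by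
  choose x _ hx using fun k => hr.inFlag h h' k
  rw [gramDelta_eq_gramDet, gramDelta_eq_gramDet, ← hr.eq t ht]
  exact gramDet_of_triangular _ (x := fun k b => x k b t) fun k _ =>
    eq_add_of_sub_eq' (hx k t ht)

end IsReparametrization

end

section

variable {n : ℕ} {G : EuclideanSpace ℝ (Fin n) → Matrix (Fin n) (Fin n) ℝ}
  {c e : ℝ → EuclideanSpace ℝ (Fin n)} {J : Set ℝ} {s f : ℝ → ℝ}

/-- A function with a smooth derivative on an open set is smooth; this makes the inverse function
theorem available for the parameter change. -/
theorem contDiffAt_of_hasDerivAt (hJ : IsOpen J) (hs : ∀ t ∈ J, HasDerivAt s (f t) t)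
    (hf : ∀ t ∈ J, ContDiffAt ℝ ∞ f t) {t : ℝ} (ht : t ∈ J) : ContDiffAt ℝ ∞ s t := by
  have : ContDiffOn ℝ ∞ s J := by
    refine (contDiffOn_infty_iff_deriv_of_isOpen hJ).2
      ⟨fun t ht => (hs t ht).differentiableAt.differentiableWithinAt, ?_⟩
    exact ContDiffOn.congr (fun t ht => (hf t ht).contDiffWithinAt) fun t ht => (hs t ht).deriv
  exact this.contDiffAt (hJ.mem_nhds ht)

/-- A curve `e` with `e ∘ s = c`, where `c` is regular and `s` has a smooth positive derivative,
is regular on the range of `s`, and `c` is a reparametrization of `e`. -/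
theorem IsRegularCurve.of_reparametrization (h : IsRegularCurve G c J)
    (hs : ∀ t ∈ J, HasDerivAt s (f t) t) (hf : ∀ t ∈ J, ContDiffAt ℝ ∞ f t)
    (hpos : ∀ t ∈ J, 0 < f t) (he : ∀ t ∈ J, c t = e (s t)) :
    IsRegularCurve G e (s '' J) ∧ IsReparametrization c e J (s '' J) s f := by
  have hsmooth : ∀ t ∈ J, ContDiffAt ℝ ∞ s t := fun t ht =>
    contDiffAt_of_hasDerivAt h.isOpen hs hf ht
  have hstrict : ∀ t ∈ J, HasStrictDerivAt s (f t) t := fun t ht =>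
    (hsmooth t ht).hasStrictDerivAt' (hs t ht) (by simp)
  have hopen : IsOpen (s '' J) := by
    rw [isOpen_iff_mem_nhds]
    rintro _ ⟨t, ht, rfl⟩
    -- A nonzero strict derivative maps neighbourhoods to neighbourhoods, so the image of `J` is
    -- open.
    rw [← (hstrict t ht).map_nhds_eq (hpos t ht).ne']
    exact Filter.image_mem_map (h.isOpen.mem_nhds ht)
  have hesmooth : ∀ t ∈ J, ContDiffAt ℝ ∞ e (s t) := by
    intro t ht
    have hd := (hs t ht).hasFDerivAt_equiv (hpos t ht).ne'
    have hn : (∞ : WithTop ℕ∞) ≠ 0 := by simp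
    have hst := (hsmooth t ht).hasStrictFDerivAt' hd hn
    -- Nothing is known about `e` beyond its values on `s '' J`. Near `s t` it equals `c ∘ l` with
    -- `l` a smooth local inverse of `s`; global injectivity of `s` plays no role.
    set l := (hsmooth t ht).localInverse hd hn with hl
    have hlt : l (s t) = t := (hsmooth t ht).localInverse_apply_image hd hn
    have hls : ContDiffAt ℝ ∞ l (s t) := (hsmooth t ht).to_localInverse hd hn
    have hright : ∀ᶠ r in nhds (s t), s (l r) = r := hst.eventually_right_inverse
    have hmem : ∀ᶠ r in nhds (s t), l r ∈ J :=
      hls.continuousAt.eventually_mem (by rw [hlt]; exact h.isOpen.mem_nhds ht)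
    have hcl : ContDiffAt ℝ ∞ (c ∘ l) (s t) :=
      ContDiffAt.comp (s t) (by rw [hlt]; exact h.smooth t ht) hls
    refine hcl.congr_of_eventuallyEq ?_
    filter_upwards [hright, hmem] with r hr hm
    rw [Function.comp_apply, he _ hm, hr]
  refine ⟨⟨hopen, h.symm, ?_, ?_, ?_, ?_⟩, ⟨fun t ht => ⟨t, ht, rfl⟩, he, hs, hf, hpos⟩⟩
  · rintro _ ⟨t, ht, rfl⟩
    rw [← he t ht]
    exact h.posDef t ht
  · rintro _ ⟨t, ht, rfl⟩
    rw [← he t ht]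
    exact h.smooth_metric t ht
  · rintro _ ⟨t, ht, rfl⟩
    exact hesmooth t ht
  · rintro _ ⟨t, ht, rfl⟩ h0
    refine h.velocity_ne t ht (funext fun k => ?_)
    rw [velocity_comp ((hesmooth t ht).differentiableAt (by simp)) (hs t ht)
      (Filter.eventually_of_mem (h.isOpen.mem_nhds ht) he), h0]
    simp

/-- The higher curvature of the conformal arc-length parametrization `e` in terms of the Gram
determinants in an arbitrary parametrization `c = e ∘ s`. -/
theorem IsRegularCurve.higherCurvature_arcLength (h : IsRegularCurve G c J) {N : ℕ}
    (hli : ∀ t ∈ J, LinearIndependent ℝ (fun k : Fin N => derivedTractor G c k t))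
    (hs : ∀ t ∈ J, HasDerivAt s (arcDensity G c t ^ (1 / 4 : ℝ)) t)
    (he : ∀ t ∈ J, c t = e (s t)) {t : ℝ} (ht : t ∈ J) (m : ℕ) (hm : m + 5 ≤ N) :
    higherCurvature G e (m + 2) (s t) =
      Real.sqrt (gramDelta G c (m + 3) t * gramDelta G c (m + 5) t)
        / (-gramDelta G c (m + 4) t * (-gramDelta G c 4 t) ^ (1 / 4 : ℝ)) := by
  have hΔ : ∀ t ∈ J, ∀ j, 3 ≤ j → j ≤ N → gramDelta G c j t ≠ 0 := fun t ht j h3 hj =>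
    h.gramDelta_ne_zero ht h3 hj (hli t ht)
  -- The determinant is negative at index `1 + 3 = 4`, and `Φ = -Δ_4`, so the fourth root is smooth
  -- and positive.
  have hΦ : ∀ t ∈ J, 0 < arcDensity G c t := fun t ht => by
    have := h.gramDelta_neg hΔ ht 1 (by omega)
    rw [h.gramDelta_four ht] at this
    linarith
  set f : ℝ → ℝ := fun τ => arcDensity G c τ ^ (1 / 4 : ℝ) with hf
  have hfpos : ∀ t ∈ J, 0 < f t := fun t ht => Real.rpow_pos_of_pos (hΦ t ht) _
  have hfs : ∀ t ∈ J, ContDiffAt ℝ ∞ f t := fun t ht => by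
    have h2 := h.contDiffAt_derivedTractor ht 2
    have h3 := h.contDiffAt_derivedTractor ht 3
    exact ContDiffAt.rpow_const_of_ne ((h.contDiffAt_tractorInner ht h3 h3).sub
      ((h.contDiffAt_tractorInner ht h2 h2).pow 2)) (hΦ t ht).ne'
  obtain ⟨h', hr⟩ := h.of_reparametrization hs hfs hfpos he
  have hΔ' : ∀ r ∈ s '' J, ∀ j, 3 ≤ j → j ≤ N → gramDelta G e j r ≠ 0 := by
    rintro _ ⟨t, ht, rfl⟩ j h3 hj
    rw [hr.gramDelta_eq h h' ht]
    refine mul_ne_zero (pow_ne_zero _ (Finset.prod_ne_zero_iff.2 fun k _ => ?_)) (hΔ t ht j h3 hj)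
    have := hfpos t ht
    positivity
  have h4 : (-gramDelta G c 4 t) ^ (1 / 4 : ℝ) = f t := by rw [h.gramDelta_four ht, neg_neg]
  have hft := hfpos t ht
  rw [h'.higherCurvature_eq hΔ' ⟨t, ht, rfl⟩ m hm, h4, hr.gramDelta_eq h h' ht,
    hr.gramDelta_eq h h' ht, hr.gramDelta_eq h h' ht, Finset.prod_range_succ _ (m + 4),
    Finset.prod_range_succ _ (m + 3)]
  have hP : 0 < ∏ k ∈ Finset.range (m + 3), f t * (f t)⁻¹ ^ k :=
    Finset.prod_pos fun k _ => by positivity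
  have ha : 0 < f t * (f t)⁻¹ ^ (m + 3) := by positivity
  -- Consecutive scaling factors differ by `f⁻¹`. In the curvature quotient all other powers of `f`
  -- cancel, and this one becomes the factor `(-Δ_4)^(1/4)` in the denominator.
  have hb : f t * (f t)⁻¹ ^ (m + 4) = f t * (f t)⁻¹ ^ (m + 3) * (f t)⁻¹ := by
    rw [pow_succ _ (m + 3)]; ring
  have hd := hΔ t ht (m + 4) (by omega) (by omega)
  rw [hb]
  generalize (∏ k ∈ Finset.range (m + 3), f t * (f t)⁻¹ ^ k) = P at *
  generalize f t * (f t)⁻¹ ^ (m + 3) = a at *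
  generalize f t = x at *
  have e1 : P ^ 2 * gramDelta G c (m + 3) t * ((P * a * (a * x⁻¹)) ^ 2 * gramDelta G c (m + 5) t) =
      (P ^ 2 * a ^ 2 * x⁻¹) ^ 2 * (gramDelta G c (m + 3) t * gramDelta G c (m + 5) t) := by ring
  rw [e1, Real.sqrt_mul (sq_nonneg _), Real.sqrt_sq (by positivity)]
  field_simp

/-! ### Curves in a manifold -/

section Manifold

variable {M : Type*} [TopologicalSpace M] [ChartedSpace (EuclideanSpace ℝ (Fin n)) M]
  [IsManifold (𝓡 n) ∞ M] (g : SmoothMetric n M)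
  {φ : OpenPartialHomeomorph M (EuclideanSpace ℝ (Fin n))}

theorem metricCoeff_symm (y : EuclideanSpace ℝ (Fin n)) (i j : Fin n) :
    metricCoeff g φ y i j = metricCoeff g φ y j i :=
  g.symm _ _ _

omit [IsManifold (𝓡 n) ∞ M] in
theorem mdifferentiable_of_mem_maximalAtlas (hφ : φ ∈ IsManifold.maximalAtlas (𝓡 n) ∞ M) :
    φ.MDifferentiable (𝓡 n) (𝓡 n) :=
  ⟨(contMDiffOn_of_mem_maximalAtlas hφ).mdifferentiableOn (by simp),
    (contMDiffOn_symm_of_mem_maximalAtlas hφ).mdifferentiableOn (by simp)⟩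

/-- The coefficient matrix is the pullback of `g` under the differential of `φ.symm`, which is
injective on the target of the chart. -/
theorem metricCoeff_posDef (hφ : φ ∈ IsManifold.maximalAtlas (𝓡 n) ∞ M)
    {y : EuclideanSpace ℝ (Fin n)} (hy : y ∈ φ.target) : (metricCoeff g φ y).PosDef := by
  refine Matrix.PosDef.of_dotProduct_mulVec_pos ?_ fun v hv => ?_
  · ext i j
    exact metricCoeff_symm g y j i
  · set L := mfderiv (𝓡 n) (𝓡 n) φ.symm y with hL
    have hinj : Function.Injective L :=
      (mdifferentiable_of_mem_maximalAtlas hφ).symm.mfderiv_injective hy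
    let w : EuclideanSpace ℝ (Fin n) := ∑ i, v i • EuclideanSpace.single i (1 : ℝ)
    have hw : w ≠ 0 := fun h0 => hv <| funext fun k => by
      have := congrArg (fun z : EuclideanSpace ℝ (Fin n) => z k) h0
      simpa [w, Pi.single_apply] using this
    have hLw : L w ≠ 0 := fun h0 => hw (hinj (h0.trans (map_zero L).symm))
    have hpos := g.pos (φ.symm y) (L w) hLw
    have hLw' : L w = ∑ i, v i • L (EuclideanSpace.single i (1 : ℝ)) := by
      simp only [w]
      erw [map_sum]
      exact Finset.sum_congr rfl fun i _ => map_smul L _ _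
    rw [hLw'] at hpos
    simp only [map_sum, map_smul, sum_apply,
      smul_apply, smul_eq_mul] at hpos
    refine hpos.trans_eq ?_
    simp only [dotProduct, Matrix.mulVec, star_trivial, Finset.mul_sum]
    rw [Finset.sum_comm]
    exact Finset.sum_congr rfl fun i _ => Finset.sum_congr rfl fun j _ => by
      simp only [metricCoeff, Matrix.of_apply, ← hL]
      ring

end Manifold

end

/-! ### Smoothness of metric coefficients and of curves in a chart -/

section

variable {n : ℕ} {M : Type*} [TopologicalSpace M] [ChartedSpace (EuclideanSpace ℝ (Fin n)) M]
  [IsManifold (𝓡 n) ∞ M] (g : SmoothMetric n M)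
  {φ : OpenPartialHomeomorph M (EuclideanSpace ℝ (Fin n))}

/-- The coordinate field is the tangent map of `φ.symm` composed with the constant section `z ↦ (z,
v)`, and both are smooth. -/
theorem contMDiffAt_coordinateField (hφ : φ ∈ IsManifold.maximalAtlas (𝓡 n) ∞ M)
    {y : EuclideanSpace ℝ (Fin n)} (hy : y ∈ φ.target) (v : EuclideanSpace ℝ (Fin n)) :
    ContMDiffAt (𝓡 n) (𝓡 n).tangent ∞ (fun z => Bundle.TotalSpace.mk' (EuclideanSpace ℝ (Fin n))
      (E := fun x : M => TangentSpace (𝓡 n) x) (φ.symm z)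
      (mfderiv (𝓡 n) (𝓡 n) φ.symm z v)) y := by
  have hT := (contMDiffOn_symm_of_mem_maximalAtlas hφ).contMDiffOn_tangentMapWithin (m := ∞)
    (by simp) φ.open_target.uniqueMDiffOn
  have hs : ContMDiffOn (𝓡 n) (𝓡 n).tangent ∞ (fun z : EuclideanSpace ℝ (Fin n) =>
      (⟨z, v⟩ : TangentBundle (𝓡 n) (EuclideanSpace ℝ (Fin n)))) φ.target :=
    contMDiffOn_vectorSpace_iff_contDiffOn.2 contDiffOn_const
  have h := (hT.comp hs fun z hz => hz).contMDiffAt (φ.open_target.mem_nhds hy)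
  refine h.congr_of_eventuallyEq (Filter.eventually_of_mem (φ.open_target.mem_nhds hy) ?_)
  intro z hz
  simp only [Function.comp_apply, tangentMapWithin,
    mfderivWithin_of_mem_nhds (φ.open_target.mem_nhds hz)]

theorem contDiffAt_metricCoeff (hφ : φ ∈ IsManifold.maximalAtlas (𝓡 n) ∞ M)
    {y : EuclideanSpace ℝ (Fin n)} (hy : y ∈ φ.target) (i j : Fin n) :
    ContDiffAt ℝ ∞ (fun z => metricCoeff g φ z i j) y := by
  have hb : ContMDiffAt (𝓡 n) (𝓡 n) ∞ φ.symm y :=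
    (contMDiffOn_symm_of_mem_maximalAtlas hφ).contMDiffAt (φ.open_target.mem_nhds hy)
  have h : ContMDiffAt (𝓡 n) ((𝓡 n).prod 𝓘(ℝ)) ∞
      (fun z => Bundle.TotalSpace.mk' ℝ (E := Bundle.Trivial M ℝ) (φ.symm z)
        (metricCoeff g φ z i j)) y := by
    apply ContMDiffAt.clm_bundle_apply₂ (F₁ := EuclideanSpace ℝ (Fin n))
      (F₂ := EuclideanSpace ℝ (Fin n))
    · exact ContMDiffAt.comp y g.contMDiff.contMDiffAt hb
    · exact contMDiffAt_coordinateField hφ hy _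
    · exact contMDiffAt_coordinateField hφ hy _
  rw [Bundle.contMDiffAt_totalSpace] at h
  exact h.2.contDiffAt

theorem isRegularCurve_chart (hφ : φ ∈ IsManifold.maximalAtlas (𝓡 n) ∞ M) {I : Set ℝ}
    (hI : IsOpen I) {γ : ℝ → M} (hγ : ContMDiffOn 𝓘(ℝ, ℝ) (𝓡 n) ∞ γ I)
    (hreg : ∀ t ∈ I, mfderiv 𝓘(ℝ, ℝ) (𝓡 n) γ t ≠ 0) :
    IsRegularCurve (metricCoeff g φ) (fun τ => φ (γ τ)) (I ∩ γ ⁻¹' φ.source) := by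
  have hc : ∀ t ∈ I ∩ γ ⁻¹' φ.source, ContDiffAt ℝ ∞ (fun τ => φ (γ τ)) t := by
    rintro t ⟨htI, ht⟩
    have h1 := (contMDiffOn_of_mem_maximalAtlas hφ).contMDiffAt (φ.open_source.mem_nhds ht)
    exact (h1.comp t (hγ.contMDiffAt (hI.mem_nhds htI))).contDiffAt
  refine ⟨hγ.continuousOn.isOpen_inter_preimage hI φ.open_source, metricCoeff_symm g,
    fun t ht => metricCoeff_posDef g hφ (φ.map_source ht.2),
    fun t ht => contDiffAt_metricCoeff g hφ (φ.map_source ht.2), hc, ?_⟩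
  rintro t ht h0
  have hd : DifferentiableAt ℝ (fun τ => φ (γ τ)) t := (hc t ht).differentiableAt (by simp)
  have hderiv : deriv (fun τ => φ (γ τ)) t = 0 := by
    rw [deriv_eq_sum_velocity hd, h0]
    simp
  have hf : fderiv ℝ (fun τ => φ (γ τ)) t = 0 := by
    ext
    simp [hderiv]
  have hφd := mdifferentiable_of_mem_maximalAtlas hφ
  have hγd : MDifferentiableAt 𝓘(ℝ, ℝ) (𝓡 n) γ t :=
    (hγ.contMDiffAt (hI.mem_nhds ht.1)).mdifferentiableAt (by simp)
  have hcomp := mfderiv_comp t (hφd.mdifferentiableAt ht.2) hγd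
  have hf' : mfderiv 𝓘(ℝ, ℝ) (𝓡 n) (φ ∘ γ) t = 0 := by
    rw [mfderiv_eq_fderiv]
    exact hf
  -- A zero coordinate velocity would give a zero derivative of `γ`, since the differential of the
  -- chart is injective.
  refine hreg t ht.1 (ContinuousLinearMap.ext fun v => hφd.mfderiv_injective ht.2 ?_)
  have := congrArg (fun L => L v) (hcomp.symm.trans hf')
  exact this.trans (map_zero (mfderiv (𝓡 n) (𝓡 n) φ (γ t))).symm

end

end ConformalCurve

end

open ConformalCurve in
theorem theorem4 {n : ℕ} {M : Type*} [TopologicalSpace M]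
    [ChartedSpace (EuclideanSpace ℝ (Fin n)) M] [IsManifold (𝓡 n) ∞ M]
    (C : ConformalStructure n M) (g : SmoothMetric n M) (hg : g ∈ C.metrics)
    (φ : OpenPartialHomeomorph M (EuclideanSpace ℝ (Fin n)))
    (hφ : φ ∈ IsManifold.maximalAtlas (𝓡 n) ∞ M)
    (I : Set ℝ) (hI : IsOpen I) (γ : ℝ → M)
    (hγ : ContMDiffOn 𝓘(ℝ, ℝ) (𝓡 n) ∞ γ I)
    (hreg : ∀ t ∈ I, mfderiv 𝓘(ℝ, ℝ) (𝓡 n) γ t ≠ 0)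
    (hgen : ∀ t ∈ I, γ t ∈ φ.source → LinearIndependent ℝ
      (fun k : Fin (n + 2) => derivedTractor (metricCoeff g φ) (fun τ => φ (γ τ)) k t))
    (s : ℝ → ℝ)
    (hs : ∀ t ∈ I, γ t ∈ φ.source →
      HasDerivAt s (arcDensity (metricCoeff g φ) (fun τ => φ (γ τ)) t ^ (1 / 4 : ℝ)) t)
    (δ : ℝ → M) (hδ : ∀ t ∈ I, δ (s t) = γ t)
    (i : ℕ) (hi2 : 2 ≤ i) (hin : i + 1 ≤ n)
    (t : ℝ) (ht : t ∈ I) (htφ : γ t ∈ φ.source) :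
    higherCurvature (metricCoeff g φ) (fun τ => φ (δ τ)) i (s t) =
      Real.sqrt (gramDelta (metricCoeff g φ) (fun τ => φ (γ τ)) (i + 1) t
          * gramDelta (metricCoeff g φ) (fun τ => φ (γ τ)) (i + 3) t)
        / (-gramDelta (metricCoeff g φ) (fun τ => φ (γ τ)) (i + 2) t
          * (-gramDelta (metricCoeff g φ) (fun τ => φ (γ τ)) 4 t) ^ (1 / 4 : ℝ)) := by
  have h := isRegularCurve_chart g hφ hI hγ hreg
  obtain ⟨m, rfl⟩ : ∃ m, i = m + 2 := ⟨i - 2, by omega⟩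
  -- `T, U, …, U^(n)` are `n + 2` tractors, and with `i = m + 2` the largest determinant `Δ_{i+3}`
  -- has order `m + 5 ≤ n + 2`.
  exact h.higherCurvature_arcLength (N := n + 2) (fun t ht => hgen t ht.1 ht.2)
    (fun t ht => hs t ht.1 ht.2) (fun t ht => by rw [hδ t ht.1]) ⟨ht, htφ⟩ m (by omega)
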